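/- Let $\mathbb{F}_q$ be a finite field with $q$ elements. On the field $\mathbb{F}_q((T^{-1}))$ put the absolute value given by $|0|=0$ and $|\xi|=q^{-N}$ for $\xi=\sum_{n\ge N}a_nT^{-n}$ with $a_N\neq 0$. The height $H(P)$ of a polynomial $P\in\mathbb{F}_q[T][X]$ is the maximum of the absolute values of its coefficients. The degree and the height $H(\alpha)$ of an element $\alpha\in\mathbb{F}_q((T^{-1}))$ that is algebraic over $\mathbb{F}_q(T)$ are those of its minimal defining polynomial over $\mathbb{F}_q[T]$, that is, of the irreducible polynomial in $\mathbb{F}_q[T][X]$, unique up to a factor in $\mathbb{F}_q^{\times}$, which vanishes at $\alpha$. For $\xi\in\mathbb{F}_q((T^{-1}))$ and an integer $n\ge 1$, let $w_n(\xi)$ be the supremum (in $\mathbb{R}\cup\{\pm\infty\}$) of the real numbers $w$ for which $$0<|P(\xi)|<H(P)^{-w}$$ has infinitely many solutions in polynomials $P\in\mathbb{F}_q[T][X]$ of degree at most $n$, and let $w_n^*(\xi)$ be the supremum of the real numbers $w^*$ for which $$0<|\xi-\alpha|<H(\alpha)^{-w^*-1}$$ has infinitely many solutions in algebraic elements $\alpha\in\mathbb{F}_q((T^{-1}))$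 of degree at most $n$. Set $$w(\xi)=\limsup_{n\to\infty}\frac{w_n(\xi)}{n},\qquad w^*(\xi)=\limsup_{n\to\infty}\frac{w_n^*(\xi)}{n}.$$ The element $\xi$ belongs to the class $A$ if $w(\xi)=0$; to the class $S$ if $0<w(\xi)<\infty$; to the class $T$ if $w(\xi)=\infty$ and $w_n(\xi)<\infty$ for every $n\ge 1$; to the class $U$ if $w(\xi)=\infty$ and $w_n(\xi)=\infty$ for some $n\ge 1$. The classes $A^*,S^*,T^*,U^*$ are defined in the same way, with $w_n^*$ and $w^*$ in place of $w_n$ and $w$. Then, in $\mathbb{F}_q((T^{-1}))$, the classes $A$, $S$, $T$, $U$ coincide with the classes $A^*$, $S^*$, $T^*$, $U^*$, respectively. -/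

import Mathlib

noncomputable section

open Polynomial

namespace MahlerKoksma

/-- For a finite field `F`, the field `F((T⁻¹))` is `LaurentSeries F`, the variable of the Laurent
series being `T⁻¹`: the series `∑ aₙ T⁻ⁿ` has `n`-th coefficient `aₙ`. The element `T` is therefore
the monomial of exponent `-1`, and this is the embedding of `F[T]` that sends `T` to it. -/
def polyEmb (F : Type*) [Field F] : F[X] →+* LaurentSeries F :=
  Polynomial.eval₂RingHom (HahnSeries.C : F →+* LaurentSeries F) (HahnSeries.single (-1 : ℤ) (1 : F))

variable {F : Type*} [Field F]

/-- The absolute value `|ξ| = q ^ (-N)`, where `q` is the cardinality of `F` and `N` is the least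
exponent of `T⁻¹` in `ξ`; `|0| = 0`. -/
def absVal (ξ : LaurentSeries F) : ℝ :=
  open Classical in if ξ = 0 then 0 else (Nat.card F : ℝ) ^ (-ξ.order)

/-- The value `P(ξ)` of a polynomial `P` over `F[T]`. -/
def evalAt (P : F[X][X]) (ξ : LaurentSeries F) : LaurentSeries F :=
  P.eval₂ (polyEmb F) ξ

/-- The height of a polynomial over `F[T]`: the maximum of the absolute values of its
coefficients. -/
def polyHeight (P : F[X][X]) : ℝ :=
  (Finset.range (P.natDegree + 1)).sup' Finset.nonempty_range_add_one
    fun i => absVal (polyEmb F (P.coeff i))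

/-- `P` is a minimal defining polynomial over `F[T]` of `α`: it is irreducible in `F[T][X]`
(in particular it is primitive) and vanishes at `α`. It exists exactly when `α` is algebraic, and is
unique up to a factor in `Fˣ`, so that the degree and the height of `α` are those of any such `P`;
see `exists_isMinDefPoly_iff` and `IsMinDefPoly.associated`. -/
def IsMinDefPoly (P : F[X][X]) (α : LaurentSeries F) : Prop :=
  Irreducible P ∧ evalAt P α = 0

/-- The exponent `wₙ(ξ)`: the supremum in `[-∞, +∞]` of the real `w` such that
`0 < |P(ξ)| < H(P) ^ (-w)` for infinitely many `P` in `F[T][X]` of degree at most `n`. -/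
def wExp (ξ : LaurentSeries F) (n : ℕ) : EReal :=
  sSup ((fun w : ℝ => (w : EReal)) '' {w : ℝ |
    {P : F[X][X] | P.natDegree ≤ n ∧ 0 < absVal (evalAt P ξ) ∧
      absVal (evalAt P ξ) < polyHeight P ^ (-w)}.Infinite})

/-- The exponent `wₙ*(ξ)`: the supremum in `[-∞, +∞]` of the real `w` such that
`0 < |ξ - α| < H(α) ^ (-w - 1)` for infinitely many algebraic `α` in `F((T⁻¹))` of degree at
most `n`. -/
def wStarExp (ξ : LaurentSeries F) (n : ℕ) : EReal :=
  sSup ((fun w : ℝ => (w : EReal)) '' {w : ℝ |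
    {α : LaurentSeries F | ∃ P : F[X][X], IsMinDefPoly P α ∧ P.natDegree ≤ n ∧
      0 < absVal (ξ - α) ∧ absVal (ξ - α) < polyHeight P ^ (-w - 1)}.Infinite})

/-- The limsup of `wₙ / n` for a sequence of exponents. -/
def limExp (w : ℕ → EReal) : EReal :=
  Filter.limsup (fun n : ℕ => w n / ((n : ℝ) : EReal)) Filter.atTop

variable (F)

/-- Mahler's class `A`. -/
def classA : Set (LaurentSeries F) := {ξ | limExp (wExp ξ) = 0}

/-- Mahler's class `S`. -/
def classS : Set (LaurentSeries F) := {ξ | 0 < limExp (wExp ξ) ∧ limExp (wExp ξ) < ⊤}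

/-- Mahler's class `T`. -/
def classT : Set (LaurentSeries F) :=
  {ξ | limExp (wExp ξ) = ⊤ ∧ ∀ n : ℕ, 1 ≤ n → wExp ξ n < ⊤}

/-- Mahler's class `U`. -/
def classU : Set (LaurentSeries F) :=
  {ξ | limExp (wExp ξ) = ⊤ ∧ ∃ n : ℕ, 1 ≤ n ∧ wExp ξ n = ⊤}

/-- Koksma's class `A*`. -/
def classAStar : Set (LaurentSeries F) := {ξ | limExp (wStarExp ξ) = 0}

/-- Koksma's class `S*`. -/
def classSStar : Set (LaurentSeries F) :=
  {ξ | 0 < limExp (wStarExp ξ) ∧ limExp (wStarExp ξ) < ⊤}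

/-- Koksma's class `T*`. -/
def classTStar : Set (LaurentSeries F) :=
  {ξ | limExp (wStarExp ξ) = ⊤ ∧ ∀ n : ℕ, 1 ≤ n → wStarExp ξ n < ⊤}

/-- Koksma's class `U*`. -/
def classUStar : Set (LaurentSeries F) :=
  {ξ | limExp (wStarExp ξ) = ⊤ ∧ ∃ n : ℕ, 1 ≤ n ∧ wStarExp ξ n = ⊤}

variable {F}

theorem polyEmb_coeff (R : F[X]) (i : ℕ) : (polyEmb F R).coeff (-(i : ℤ)) = R.coeff i := by
  have key : ∀ k : ℕ, (HahnSeries.single (-1 : ℤ) (1 : F) : LaurentSeries F) ^ k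
      = HahnSeries.single (-(k : ℤ)) 1 := by
    intro k
    simp [HahnSeries.single_pow]
  induction R using Polynomial.induction_on' with
  | add p q hp hq => simp [hp, hq]
  | monomial k a =>
    simp only [polyEmb, Polynomial.coe_eval₂RingHom, Polynomial.eval₂_monomial, key,
      HahnSeries.C_apply, HahnSeries.single_mul_single, Polynomial.coeff_monomial]
    simp [HahnSeries.coeff_single, eq_comm]

theorem polyEmb_injective : Function.Injective (polyEmb F) := by
  intro R S h
  ext i
  rw [← polyEmb_coeff, ← polyEmb_coeff, h]

theorem IsMinDefPoly.natDegree_ne_zero {P : F[X][X]} {α : LaurentSeries F}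
    (h : IsMinDefPoly P α) : P.natDegree ≠ 0 := by
  intro h0
  obtain ⟨hi, hz⟩ := h
  rw [Polynomial.eq_C_of_natDegree_eq_zero h0] at hz hi
  rw [evalAt, Polynomial.eval₂_C, map_eq_zero_iff _ polyEmb_injective] at hz
  rw [hz, map_zero] at hi
  exact not_irreducible_zero hi

/-- The minimal defining polynomial is unique up to a unit. -/
theorem IsMinDefPoly.associated {P Q : F[X][X]} {α : LaurentSeries F}
    (hP : IsMinDefPoly P α) (hQ : IsMinDefPoly Q α) : Associated P Q := by
  let K := FractionRing F[X]
  let φ : K →+* LaurentSeries F := IsFractionRing.lift (A := F[X]) polyEmb_injective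
  have hφ : φ.comp (algebraMap F[X] K) = polyEmb F := by
    ext1 <;> ext <;> simp [φ]
  have hroot : ∀ R : F[X][X], evalAt R α = 0 → (R.map (algebraMap F[X] K)).eval₂ φ α = 0 := by
    intro R hR
    rw [Polynomial.eval₂_map, hφ]
    exact hR
  have hPp := hP.1.isPrimitive hP.natDegree_ne_zero
  have hPi := (hPp.irreducible_iff_irreducible_map_fraction_map (K := K)).1 hP.1
  have hdvd : P.map (algebraMap F[X] K) ∣ Q.map (algebraMap F[X] K) := by
    by_contra hnd
    obtain ⟨a, b, hab⟩ := (hPi.coprime_iff_not_dvd).2 hnd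
    have h1 := congrArg (Polynomial.eval₂ φ α) hab
    simp [Polynomial.eval₂_mul, Polynomial.eval₂_add, hroot P hP.2, hroot Q hQ.2] at h1
  exact hP.1.associated_of_dvd hQ.1 (hPp.dvd_of_fraction_map_dvd_fraction_map hdvd)

/-- A minimal defining polynomial exists exactly for the roots of nonzero polynomials. -/
theorem exists_isMinDefPoly_iff {α : LaurentSeries F} :
    (∃ P : F[X][X], IsMinDefPoly P α) ↔ ∃ P : F[X][X], P ≠ 0 ∧ evalAt P α = 0 := by
  refine ⟨fun ⟨P, hi, hz⟩ => ⟨P, hi.ne_zero, hz⟩, ?_⟩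
  rintro ⟨P, h0, hz⟩
  obtain ⟨f, hf, u, rfl⟩ := WfDvdMonoid.exists_factors P h0
  let ψ := Polynomial.eval₂RingHom (polyEmb F) α
  have h1 : ψ f.prod * ψ u = 0 := by
    rw [← map_mul]
    exact hz
  have h2 : ψ f.prod = 0 := (mul_eq_zero.1 h1).resolve_right (u.isUnit.map ψ).ne_zero
  rw [map_multiset_prod, Multiset.prod_eq_zero_iff, Multiset.mem_map] at h2
  obtain ⟨R, hR, hR0⟩ := h2
  exact ⟨R, hf R hR, hR0⟩

end MahlerKoksma

end

noncomputable section

open Polynomial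

namespace MahlerKoksma

variable {F : Type*} [Field F]

set_option linter.unusedSectionVars false

/-! ### The absolute value -/

/-! For `n ≥ 1` the exponents satisfy `wₙ* ≤ wₙ ≤ wₙ* + 8n` (`wStarExp_le_wExp`,
`wExp_le_wStarExp_add`). Hence they are infinite together, and after division by `n` the upper
limits differ by at most 8, so these are infinite together too. It remains to decide when the limits
vanish, and both vanish exactly for algebraic `ξ`.

The left inequality holds because the minimal polynomial of a number close to `ξ` is small at `ξ`.
For the right one, a polynomial that is very small at `ξ` must yield a root near `ξ` lying in
`F((T⁻¹))` itself. Newton approximation (`exists_root_near`) gives it if the derivative at `ξ` is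
not too small. For a separable irreducible `P` a Bézout identity between `P` and its derivative
ensures this, at a cost of `H(P) ^ (3n)` (`one_le_absVal_derivative`). Irreducibility is obtained by
factoring, heights being multiplicative. Separability uses that `F` is perfect: if `P' = 0`, then `P
= ∑ T ^ j * Q_j ^ p` over `j < p`, the nonzero terms at `ξ` have distinct absolute values, and so
`|P(ξ)|` is at least some nonzero `|Q_j(ξ)| ^ p`, where `Q_j` has smaller degree and height
(`exists_pth_root`, `exists_separable_irreducible`).

If `ξ` is algebraic, Liouville's inequality bounds `wₙ` independently of `n`
(`wExp_le_of_isMinDefPoly`), and both limits are 0. If `ξ` is transcendental, `half_le_wStarExp`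
gives `w*` at index `2n` at least `n / 2`, and both limits are positive. There two coprime
polynomials `P`, `Q`, small at `ξ`, serve to round a large multiple of `X - ξ` to an integral
polynomial: the rounding error is a combination of `P` and `Q` with coefficients bounded by 1, hence
small at `ξ`, while the derivative at `ξ` stays as large as the height, up to a constant. Newton
approximation again provides the root. -/

theorem one_lt_card [Finite F] : (1 : ℝ) < Nat.card F := by
  exact_mod_cast Finite.one_lt_card (α := F)

theorem card_pos [Finite F] : (0 : ℝ) < Nat.card F := zero_lt_one.trans one_lt_card

theorem absVal_zero : absVal (0 : LaurentSeries F) = 0 := by simp [absVal]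

theorem absVal_of_ne_zero {x : LaurentSeries F} (h : x ≠ 0) :
    absVal x = (Nat.card F : ℝ) ^ (-x.order) := by simp [absVal, h]

theorem absVal_nonneg (x : LaurentSeries F) : 0 ≤ absVal x := by
  unfold absVal
  split_ifs <;> positivity

section Finite

variable [Finite F]

theorem absVal_pos {x : LaurentSeries F} (h : x ≠ 0) : 0 < absVal x := by
  rw [absVal_of_ne_zero h]
  exact zpow_pos card_pos _

theorem absVal_eq_zero {x : LaurentSeries F} : absVal x = 0 ↔ x = 0 :=
  ⟨fun h => by_contra fun hx => (absVal_pos hx).ne' h, fun h => h ▸ absVal_zero⟩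

theorem absVal_pos_iff {x : LaurentSeries F} : 0 < absVal x ↔ x ≠ 0 :=
  ⟨fun h hx => h.ne' (absVal_eq_zero.2 hx), absVal_pos⟩

theorem absVal_mul (x y : LaurentSeries F) : absVal (x * y) = absVal x * absVal y := by
  by_cases hx : x = 0
  · simp [hx, absVal_zero]
  by_cases hy : y = 0
  · simp [hy, absVal_zero]
  rw [absVal_of_ne_zero hx, absVal_of_ne_zero hy, absVal_of_ne_zero (mul_ne_zero hx hy),
    HahnSeries.order_mul hx hy, neg_add, zpow_add₀ card_pos.ne']

theorem absVal_add_le (x y : LaurentSeries F) : absVal (x + y) ≤ max (absVal x) (absVal y) := by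
  by_cases hx : x = 0
  · simp [hx]
  by_cases hy : y = 0
  · simp [hy]
  by_cases hxy : x + y = 0
  · rw [hxy, absVal_zero]
    exact le_max_of_le_left (absVal_nonneg x)
  rw [absVal_of_ne_zero hx, absVal_of_ne_zero hy, absVal_of_ne_zero hxy]
  have h := HahnSeries.min_order_le_order_add hxy
  rcases min_le_iff.1 h with h | h
  · exact le_max_of_le_left (zpow_le_zpow_right₀ one_lt_card.le (neg_le_neg h))
  · exact le_max_of_le_right (zpow_le_zpow_right₀ one_lt_card.le (neg_le_neg h))

variable (F) in
/-- `absVal` as an absolute value. -/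
def absValue : AbsoluteValue (LaurentSeries F) ℝ where
  toFun := absVal
  map_mul' := absVal_mul
  nonneg' := absVal_nonneg
  eq_zero' _ := absVal_eq_zero
  add_le' x y := (absVal_add_le x y).trans
    (max_le_add_of_nonneg (absVal_nonneg x) (absVal_nonneg y))

theorem absValue_apply (x : LaurentSeries F) : absValue F x = absVal x := rfl

theorem isNonarchimedean_absValue : IsNonarchimedean (absValue F) := absVal_add_le

theorem absVal_one : absVal (1 : LaurentSeries F) = 1 := map_one (absValue F)

theorem absVal_neg (x : LaurentSeries F) : absVal (-x) = absVal x := (absValue F).map_neg x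

theorem absVal_sub_comm (x y : LaurentSeries F) : absVal (x - y) = absVal (y - x) :=
  (absValue F).map_sub x y

theorem absVal_pow (x : LaurentSeries F) (n : ℕ) : absVal (x ^ n) = absVal x ^ n :=
  map_pow (absValue F) x n

theorem absVal_div (x y : LaurentSeries F) : absVal (x / y) = absVal x / absVal y :=
  map_div₀ (absValue F) x y

theorem absVal_sub_le (x y : LaurentSeries F) : absVal (x - y) ≤ max (absVal x) (absVal y) := by
  rw [sub_eq_add_neg, ← absVal_neg y]
  exact absVal_add_le _ _

theorem absVal_sum_le {ι : Type*} (s : Finset ι) (f : ι → LaurentSeries F) {B : ℝ} (hB : 0 ≤ B)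
    (h : ∀ i ∈ s, absVal (f i) ≤ B) : absVal (∑ i ∈ s, f i) ≤ B := by
  classical
  induction s using Finset.induction_on with
  | empty => simpa [absVal_zero] using hB
  | insert a s ha ih =>
    rw [Finset.sum_insert ha]
    exact (absVal_add_le _ _).trans (max_le (h a (by simp))
      (ih fun i hi => h i (Finset.mem_insert_of_mem hi)))

theorem absVal_add_eq_left {x y : LaurentSeries F} (h : absVal y < absVal x) :
    absVal (x + y) = absVal x :=
  IsNonarchimedean.add_eq_left_of_lt (f := absValue F) isNonarchimedean_absValue h

theorem absVal_sub_eq_left {x y : LaurentSeries F} (h : absVal y < absVal x) :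
    absVal (x - y) = absVal x := by
  rw [sub_eq_add_neg]
  exact absVal_add_eq_left (by rwa [absVal_neg])

/-- The absolute value is at most `q ^ (-m)` exactly when all coefficients below `m` vanish. -/
theorem absVal_le_zpow_iff {x : LaurentSeries F} {m : ℤ} :
    absVal x ≤ (Nat.card F : ℝ) ^ (-m) ↔ ∀ i < m, x.coeff i = 0 := by
  by_cases hx : x = 0
  · simp only [hx, absVal_zero, HahnSeries.coeff_zero, implies_true, iff_true]
    positivity
  rw [absVal_of_ne_zero hx, zpow_le_zpow_iff_right₀ one_lt_card, neg_le_neg_iff,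
    HahnSeries.le_order_iff_forall hx]

/-- Values of the absolute value are integral powers of `q`. -/
theorem absVal_lt_one_iff {x : LaurentSeries F} :
    absVal x < 1 ↔ absVal x ≤ (Nat.card F : ℝ)⁻¹ := by
  refine ⟨fun h => ?_, fun h => h.trans_lt (inv_lt_one_of_one_lt₀ one_lt_card)⟩
  by_cases hx : x = 0
  · rw [hx, absVal_zero]
    positivity
  rw [absVal_of_ne_zero hx] at h ⊢
  rw [zpow_lt_one_iff_right₀ one_lt_card] at h
  rw [← zpow_neg_one]
  exact zpow_le_zpow_right₀ one_lt_card.le (by lia)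

/-! ### Heights -/

theorem absVal_polyEmb_le_iff {a : F[X]} {n : ℕ} :
    absVal (polyEmb F a) ≤ (Nat.card F : ℝ) ^ n ↔ a.natDegree ≤ n := by
  have : (Nat.card F : ℝ) ^ n = (Nat.card F : ℝ) ^ (-(-(n : ℤ))) := by simp
  rw [this, absVal_le_zpow_iff, Polynomial.natDegree_le_iff_coeff_eq_zero]
  constructor
  · intro h i hi
    rw [← polyEmb_coeff]
    exact h _ (by lia)
  · intro h i hi
    obtain ⟨j, rfl⟩ : ∃ j : ℕ, i = -(j : ℤ) := ⟨i.natAbs, by lia⟩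
    rw [polyEmb_coeff]
    exact h j (by lia)

theorem absVal_polyEmb {a : F[X]} (ha : a ≠ 0) :
    absVal (polyEmb F a) = (Nat.card F : ℝ) ^ a.natDegree := by
  refine le_antisymm (absVal_polyEmb_le_iff.2 le_rfl) ?_
  have h0 : polyEmb F a ≠ 0 := (map_ne_zero_iff _ polyEmb_injective).2 ha
  rw [absVal_of_ne_zero h0, ← zpow_natCast]
  refine zpow_le_zpow_right₀ one_lt_card.le ?_
  have : (polyEmb F a).coeff (-(a.natDegree : ℤ)) ≠ 0 := by
    rw [polyEmb_coeff]
    simpa using ha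
  have := HahnSeries.order_le_of_coeff_ne_zero this
  lia

theorem one_le_absVal_polyEmb {a : F[X]} (ha : a ≠ 0) : 1 ≤ absVal (polyEmb F a) := by
  rw [absVal_polyEmb ha]
  exact one_le_pow₀ one_lt_card.le

variable (F) in
/-- The absolute value on `F[T]`. -/
def polyAbs : AbsoluteValue F[X] ℝ := (absValue F).comp polyEmb_injective

theorem polyAbs_apply (a : F[X]) : polyAbs F a = absVal (polyEmb F a) := rfl

theorem isNonarchimedean_polyAbs : IsNonarchimedean (polyAbs F) := fun x y => by
  simp only [polyAbs_apply, map_add]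
  exact absVal_add_le _ _

theorem polyHeight_le_iff {P : F[X][X]} {B : ℝ} (hB : 0 ≤ B) :
    polyHeight P ≤ B ↔ ∀ i, absVal (polyEmb F (P.coeff i)) ≤ B := by
  rw [polyHeight, Finset.sup'_le_iff]
  refine ⟨fun h i => ?_, fun h i _ => h i⟩
  by_cases hi : i ≤ P.natDegree
  · exact h i (by simpa [Nat.lt_succ_iff] using hi)
  · rw [Polynomial.coeff_eq_zero_of_natDegree_lt (by lia), map_zero, absVal_zero]
    exact hB

theorem polyHeight_nonneg (P : F[X][X]) : 0 ≤ polyHeight P :=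
  (absVal_nonneg _).trans (Finset.le_sup' (fun i => absVal (polyEmb F (P.coeff i)))
    (Finset.mem_range.2 (Nat.succ_pos P.natDegree)))

theorem absVal_coeff_le_polyHeight (P : F[X][X]) (i : ℕ) :
    absVal (polyEmb F (P.coeff i)) ≤ polyHeight P :=
  (polyHeight_le_iff (polyHeight_nonneg P)).1 le_rfl i

/-- This identification gives exact multiplicativity of heights (Gauss's lemma), so factoring a
polynomial loses no constants. -/
theorem polyHeight_eq_gaussNorm (P : F[X][X]) : polyHeight P = P.gaussNorm (polyAbs F) 1 := by
  apply le_antisymm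
  · rw [polyHeight_le_iff (gaussNorm_nonneg _ _ zero_le_one)]
    intro i
    simpa [polyAbs_apply] using P.le_gaussNorm (polyAbs F) zero_le_one i
  · obtain ⟨i, hi⟩ := exists_eq_gaussNorm (polyAbs F) 1 P
    rw [hi, one_pow, mul_one, polyAbs_apply]
    exact absVal_coeff_le_polyHeight P i

theorem polyHeight_mul (P Q : F[X][X]) : polyHeight (P * Q) = polyHeight P * polyHeight Q := by
  simp only [polyHeight_eq_gaussNorm]
  exact gaussNorm_mul isNonarchimedean_polyAbs zero_lt_one P Q

theorem polyHeight_add_le (P Q : F[X][X]) :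
    polyHeight (P + Q) ≤ max (polyHeight P) (polyHeight Q) := by
  simp only [polyHeight_eq_gaussNorm]
  exact isNonarchimedean_gaussNorm _ isNonarchimedean_polyAbs zero_le_one P Q

theorem one_le_polyHeight {P : F[X][X]} (hP : P ≠ 0) : 1 ≤ polyHeight P :=
  (one_le_absVal_polyEmb (leadingCoeff_ne_zero.2 hP)).trans (absVal_coeff_le_polyHeight P _)

theorem polyHeight_pos {P : F[X][X]} (hP : P ≠ 0) : 0 < polyHeight P :=
  zero_lt_one.trans_le (one_le_polyHeight hP)

theorem polyHeight_C (a : F[X]) : polyHeight (C a) = absVal (polyEmb F a) := by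
  rw [polyHeight_eq_gaussNorm, gaussNorm_C, polyAbs_apply]

theorem polyHeight_le_pow_iff {P : F[X][X]} {h : ℕ} :
    polyHeight P ≤ (Nat.card F : ℝ) ^ h ↔ ∀ i, (P.coeff i).natDegree ≤ h := by
  rw [polyHeight_le_iff (by positivity)]
  exact forall_congr' fun i => absVal_polyEmb_le_iff

theorem exists_polyHeight_eq_pow {P : F[X][X]} (hP : P ≠ 0) :
    ∃ h : ℕ, polyHeight P = (Nat.card F : ℝ) ^ h := by
  obtain ⟨i, hi⟩ := exists_eq_gaussNorm (polyAbs F) 1 P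
  rw [← polyHeight_eq_gaussNorm, one_pow, mul_one, polyAbs_apply] at hi
  have : P.coeff i ≠ 0 := fun h => by
    rw [h, map_zero, absVal_zero] at hi
    exact (polyHeight_pos hP).ne' hi
  exact ⟨_, hi.trans (absVal_polyEmb this)⟩

theorem polyHeight_le_of_dvd {P Q : F[X][X]} (h : P ∣ Q) (hQ : Q ≠ 0) :
    polyHeight P ≤ polyHeight Q := by
  obtain ⟨S, rfl⟩ := h
  rw [polyHeight_mul]
  exact le_mul_of_one_le_right (polyHeight_nonneg P) (one_le_polyHeight (right_ne_zero_of_mul hQ))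

/-- Differentiation multiplies coefficients by integers, which are constants in `F[T]` and so have
absolute value at most 1. -/
theorem polyHeight_derivative_le (P : F[X][X]) : polyHeight (derivative P) ≤ polyHeight P := by
  rw [polyHeight_le_iff (polyHeight_nonneg P)]
  intro i
  rw [coeff_derivative, map_mul, absVal_mul]
  refine (mul_le_of_le_one_right (absVal_nonneg _) ?_).trans (absVal_coeff_le_polyHeight P (i + 1))
  have : (Nat.card F : ℝ) ^ 0 = 1 := pow_zero _
  rw [← this, absVal_polyEmb_le_iff]
  have h : ((i : F[X]) + 1) = ((i + 1 : ℕ) : F[X]) := by push_cast; rfl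
  rw [h, Polynomial.natDegree_natCast]

/-- There are finitely many polynomials of bounded degree and height. -/
theorem finite_setOf_polyHeight_le (n : ℕ) (B : ℝ) :
    {P : F[X][X] | P.natDegree ≤ n ∧ polyHeight P ≤ B}.Finite := by
  obtain ⟨h, hh⟩ := pow_unbounded_of_one_lt B (one_lt_card (F := F))
  have hfin : {a : F[X] | a.natDegree ≤ h}.Finite := by
    have hinj : Set.InjOn (fun (a : F[X]) (i : Fin (h + 1)) => a.coeff i)
        {a : F[X] | a.natDegree ≤ h} := by
      intro a ha b hb hab
      ext i
      by_cases hi : i < h + 1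
      · exact congrFun hab ⟨i, hi⟩
      · rw [coeff_eq_zero_of_natDegree_lt (by have := ha.out; lia),
          coeff_eq_zero_of_natDegree_lt (by have := hb.out; lia)]
    exact Set.Finite.of_finite_image (Set.toFinite _) hinj
  have hfin' : (Set.univ.pi fun _ : Fin (n + 1) => {a : F[X] | a.natDegree ≤ h}).Finite :=
    Set.Finite.pi fun _ => hfin
  refine Set.Finite.of_finite_image (f := fun (P : F[X][X]) (i : Fin (n + 1)) => P.coeff i)
    (hfin'.subset ?_) ?_
  · rintro _ ⟨P, hP, rfl⟩ i -
    exact polyHeight_le_pow_iff.1 (hP.2.trans hh.le) i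
  · intro P hP Q hQ hPQ
    ext1 i
    by_cases hi : i < n + 1
    · exact congrFun hPQ ⟨i, hi⟩
    · rw [coeff_eq_zero_of_natDegree_lt (by have := hP.1; lia),
          coeff_eq_zero_of_natDegree_lt (by have := hQ.1; lia)]

end Finite

section Evaluation

variable [Finite F]

/-! ### Estimates for values of polynomials -/

theorem evalAt_eq_eval_map (P : F[X][X]) (ξ : LaurentSeries F) :
    evalAt P ξ = (P.map (polyEmb F)).eval ξ := (eval_map _ _).symm

theorem evalAt_add (P Q : F[X][X]) (ξ : LaurentSeries F) :
    evalAt (P + Q) ξ = evalAt P ξ + evalAt Q ξ := eval₂_add _ _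

theorem evalAt_mul (P Q : F[X][X]) (ξ : LaurentSeries F) :
    evalAt (P * Q) ξ = evalAt P ξ * evalAt Q ξ := eval₂_mul _ _

theorem evalAt_C (a : F[X]) (ξ : LaurentSeries F) : evalAt (C a) ξ = polyEmb F a := eval₂_C _ _

theorem absVal_eval_le {f : (LaurentSeries F)[X]} {B : ℝ} (hB : ∀ i, absVal (f.coeff i) ≤ B)
    {n : ℕ} (hn : f.natDegree ≤ n) (x : LaurentSeries F) :
    absVal (f.eval x) ≤ B * max 1 (absVal x) ^ n := by
  have hB0 : 0 ≤ B := (absVal_nonneg _).trans (hB 0)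
  have hE : 1 ≤ max 1 (absVal x) := le_max_left _ _
  rw [eval_eq_sum_range]
  refine absVal_sum_le _ _ (by positivity) fun i hi => ?_
  rw [absVal_mul, absVal_pow]
  refine mul_le_mul (hB i) ?_ (pow_nonneg (absVal_nonneg x) i) hB0
  calc absVal x ^ i ≤ max 1 (absVal x) ^ i :=
        pow_le_pow_left₀ (absVal_nonneg x) (le_max_right _ _) i
    _ ≤ _ := pow_le_pow_right₀ hE (by rw [Finset.mem_range] at hi; lia)

theorem absVal_evalAt_le {P : F[X][X]} {n : ℕ} (hn : P.natDegree ≤ n) (x : LaurentSeries F) :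
    absVal (evalAt P x) ≤ polyHeight P * max 1 (absVal x) ^ n := by
  rw [evalAt_eq_eval_map]
  exact absVal_eval_le (fun i => by rw [coeff_map]; exact absVal_coeff_le_polyHeight P i)
    (natDegree_map_le.trans hn) x

theorem absVal_natCast_le_one (n : ℕ) : absVal (n : LaurentSeries F) ≤ 1 :=
  isNonarchimedean_absValue.apply_natCast_le_one (f := absValue F)

/-- Taylor coefficients are values of Hasse derivatives, whose coefficients are those of `f` times
binomial integers; no factorial is divided by, so the characteristic does no harm. -/
theorem absVal_taylor_coeff_le {f : (LaurentSeries F)[X]} {B : ℝ}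
    (hB : ∀ i, absVal (f.coeff i) ≤ B) {n : ℕ} (hn : f.natDegree ≤ n) (x : LaurentSeries F)
    (k : ℕ) : absVal ((taylor x f).coeff k) ≤ B * max 1 (absVal x) ^ n := by
  rw [taylor_coeff]
  refine absVal_eval_le (fun i => ?_) ?_ x
  · rw [hasseDeriv_coeff, absVal_mul]
    exact (mul_le_of_le_one_left (absVal_nonneg _) (absVal_natCast_le_one _)).trans (hB _)
  · exact (natDegree_hasseDeriv_le f k).trans (by lia)

/-! ### Completeness and Newton approximation -/

/-- Completeness of the unit ball of `F((T⁻¹))`. -/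
theorem exists_limit (y : ℕ → LaurentSeries F) (h1 : ∀ m, absVal (y m) ≤ 1)
    (hy : ∀ m : ℕ, absVal (y (m + 1) - y m) ≤ (Nat.card F : ℝ) ^ (-(m : ℤ))) :
    ∃ z : LaurentSeries F, ∀ m : ℕ, absVal (z - y m) ≤ (Nat.card F : ℝ) ^ (-(m : ℤ)) := by
  have hneg : ∀ m, ∀ i < 0, (y m).coeff i = 0 := fun m =>
    absVal_le_zpow_iff.1 (by simpa using h1 m)
  have hstep : ∀ m : ℕ, ∀ i < (m : ℤ), (y (m + 1)).coeff i = (y m).coeff i := fun m i hi => by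
    have := absVal_le_zpow_iff.1 (hy m) i hi
    rwa [HahnSeries.coeff_sub, sub_eq_zero] at this
  have hstep' : ∀ m k : ℕ, ∀ i < (m : ℤ), (y (m + k)).coeff i = (y m).coeff i := by
    intro m k i hi
    induction k with
    | zero => rfl
    | succ k ih => rw [← add_assoc, hstep (m + k) i (by push_cast; lia), ih]
  refine ⟨HahnSeries.ofSuppBddBelow (fun i => (y (i.toNat + 1)).coeff i)
    ⟨0, fun i hi => not_lt.1 fun h => hi (hneg _ i h)⟩, fun m => absVal_le_zpow_iff.2 fun i hi => ?_⟩
  rw [HahnSeries.coeff_sub, sub_eq_zero]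
  change (y (i.toNat + 1)).coeff i = _
  by_cases hi0 : i < 0
  · rw [hneg _ i hi0, hneg _ i hi0]
  · obtain ⟨k, rfl⟩ : ∃ k, m = i.toNat + 1 + k := ⟨m - (i.toNat + 1), by lia⟩
    rw [hstep' _ k i (by lia)]

theorem eq_zero_of_forall_absVal_le {x : LaurentSeries F}
    (h : ∀ m : ℕ, absVal x ≤ (Nat.card F : ℝ) ^ (-(m : ℤ))) : x = 0 := by
  ext i
  exact absVal_le_zpow_iff.1 (h (i.toNat + 1)) i (by lia)

theorem absVal_pow_sub_pow_le {y z : LaurentSeries F} (hy : absVal y ≤ 1) (hz : absVal z ≤ 1)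
    (k : ℕ) : absVal (y ^ k - z ^ k) ≤ absVal (y - z) := by
  rw [← (Commute.all y z).mul_geom_sum₂, absVal_mul]
  refine mul_le_of_le_one_right (absVal_nonneg _) (absVal_sum_le _ _ zero_le_one fun i _ => ?_)
  rw [absVal_mul, absVal_pow, absVal_pow]
  exact mul_le_one₀ (pow_le_one₀ (absVal_nonneg _) hy) (pow_nonneg (absVal_nonneg _) _)
    (pow_le_one₀ (absVal_nonneg _) hz)

theorem absVal_eval_sub_eval_le {f : (LaurentSeries F)[X]} {B : ℝ}
    (hB : ∀ i, absVal (f.coeff i) ≤ B) {y z : LaurentSeries F} (hy : absVal y ≤ 1)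
    (hz : absVal z ≤ 1) : absVal (f.eval y - f.eval z) ≤ B * absVal (y - z) := by
  have hB0 : 0 ≤ B := (absVal_nonneg _).trans (hB 0)
  rw [eval_eq_sum_range, eval_eq_sum_range, ← Finset.sum_sub_distrib]
  refine absVal_sum_le _ _ (mul_nonneg hB0 (absVal_nonneg _)) fun i _ => ?_
  rw [← mul_sub, absVal_mul]
  exact mul_le_mul (hB i) (absVal_pow_sub_pow_le hy hz i) (absVal_nonneg _) hB0

/-- If the coefficients of `g` are less than `1` in absolute value, then `y = -1 - g(y)` has a
solution in the unit ball. -/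
theorem exists_fixed_point {g : (LaurentSeries F)[X]} (hg : ∀ i, absVal (g.coeff i) < 1) :
    ∃ y : LaurentSeries F, absVal y ≤ 1 ∧ 1 + y + g.eval y = 0 := by
  have hg' : ∀ i, absVal (g.coeff i) ≤ (Nat.card F : ℝ)⁻¹ := fun i => absVal_lt_one_iff.1 (hg i)
  -- `φ` maps the unit ball to itself and contracts distances by `1 / q`, so its iterates from 0
  -- converge to a fixed point.
  let φ : LaurentSeries F → LaurentSeries F := fun y => -1 - g.eval y
  have hφ1 : ∀ y, absVal y ≤ 1 → absVal (φ y) ≤ 1 := by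
    intro y hy
    refine (absVal_sub_le _ _).trans (max_le (by rw [absVal_neg, absVal_one]) ?_)
    have := absVal_eval_le (fun i => (hg i).le) le_rfl y
    rwa [max_eq_left hy, one_pow, mul_one] at this
  have hφ : ∀ y z, absVal y ≤ 1 → absVal z ≤ 1 →
      absVal (φ y - φ z) ≤ (Nat.card F : ℝ)⁻¹ * absVal (y - z) := by
    intro y z hy hz
    have : φ y - φ z = g.eval z - g.eval y := by simp only [φ]; ring
    rw [this, absVal_sub_comm y z]
    exact absVal_eval_sub_eval_le hg' hz hy
  let y : ℕ → LaurentSeries F := fun m => φ^[m] 0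
  have hys : ∀ m, y (m + 1) = φ (y m) := fun m => Function.iterate_succ_apply' φ m 0
  have hy1 : ∀ m, absVal (y m) ≤ 1 := by
    intro m
    induction m with
    | zero => simp [y, absVal_zero]
    | succ m ih => rw [hys]; exact hφ1 _ ih
  have hpow : ∀ m : ℕ, (Nat.card F : ℝ)⁻¹ * (Nat.card F : ℝ) ^ (-(m : ℤ))
      = (Nat.card F : ℝ) ^ (-((m + 1 : ℕ) : ℤ)) := fun m => by
    rw [← zpow_neg_one, ← zpow_add₀ card_pos.ne']
    congr 1
    push_cast
    ring
  have hyd : ∀ m : ℕ, absVal (y (m + 1) - y m) ≤ (Nat.card F : ℝ) ^ (-(m : ℤ)) := by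
    intro m
    induction m with
    | zero =>
      refine (absVal_sub_le _ _).trans ?_
      simpa using ⟨hy1 1, hy1 0⟩
    | succ m ih =>
      rw [hys (m + 1), hys m, ← hpow]
      refine (hφ _ _ (hφ1 _ (hy1 m)) (hy1 m)).trans (mul_le_mul_of_nonneg_left ?_ (by positivity))
      rwa [← hys]
  obtain ⟨z, hz⟩ := exists_limit y hy1 hyd
  have hz1 : absVal z ≤ 1 := by simpa [y] using hz 0
  refine ⟨z, hz1, ?_⟩
  have : 1 + z + g.eval z = z - φ z := by simp only [φ]; ring
  rw [this]
  refine eq_zero_of_forall_absVal_le fun m => ?_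
  have : z - φ z = (z - y (m + 1)) + (φ (y m) - φ z) := by rw [hys]; ring
  rw [this]
  refine (absVal_add_le _ _).trans (max_le ((hz (m + 1)).trans ?_) ?_)
  · exact zpow_le_zpow_right₀ one_lt_card.le (by push_cast; lia)
  · refine (hφ _ _ (hy1 m) hz1).trans ?_
    rw [absVal_sub_comm]
    exact (mul_le_of_le_one_left (absVal_nonneg _) (inv_le_one_of_one_le₀ one_lt_card.le)).trans
      (hz m)

/-- Newton approximation: a point where `f` is small compared with the square of its derivative is
close to a root of `f`. -/
theorem exists_root_near {f : (LaurentSeries F)[X]} {B : ℝ} (hB : ∀ i, absVal (f.coeff i) ≤ B)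
    {n : ℕ} (hn : f.natDegree ≤ n) {x : LaurentSeries F}
    (h : absVal (f.eval x) * (B * max 1 (absVal x) ^ n) < absVal (f.derivative.eval x) ^ 2) :
    ∃ α, f.eval α = 0 ∧
      absVal (x - α) ≤ absVal (f.eval x) / absVal (f.derivative.eval x) := by
  by_cases h0 : f.eval x = 0
  · exact ⟨x, h0, by simp [h0, absVal_zero]⟩
  set D := B * max 1 (absVal x) ^ n with hD
  set t : ℕ → LaurentSeries F := fun k => (taylor x f).coeff k with ht
  have htle : ∀ k, absVal (t k) ≤ D := fun k => absVal_taylor_coeff_le hB hn x k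
  have ht0 : t 0 = f.eval x := by simp [ht]
  have ht1 : t 1 = f.derivative.eval x := by simp [ht]
  rw [← ht0] at h0 h ⊢
  rw [← ht1] at h ⊢
  have hD0 : 0 < D := (absVal_pos h0).trans_le (htle 0)
  have ht1pos : 0 < absVal (t 1) := by
    rcases (absVal_nonneg (t 1)).lt_or_eq with h' | h'
    · exact h'
    · rw [← h', zero_pow two_ne_zero] at h
      exact absurd h (mul_pos (absVal_pos h0) hD0).not_gt
  have ht1ne : t 1 ≠ 0 := absVal_pos_iff.1 ht1pos
  -- `l` is the Newton step up to sign. Substituting `x + l * y` in the Taylor expansion and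
  -- dividing by `t 0` leaves `1 + y + g(y)`, where `g` collects the terms of order at least 2.
  set l := t 0 / t 1 with hl
  have hlabs : absVal l = absVal (t 0) / absVal (t 1) := absVal_div _ _
  have hl1 : absVal l ≤ 1 := by
    rw [hlabs, div_le_one ht1pos]
    by_contra hlt
    push Not at hlt
    have := htle 1
    nlinarith
  let g : (LaurentSeries F)[X] := ∑ k ∈ Finset.Icc 2 (n + 1), monomial k (t k * l ^ k / t 0)
  have hgc : ∀ i, absVal (g.coeff i) < 1 := by
    intro i
    simp only [g, finsetSum_coeff, coeff_monomial]
    rw [Finset.sum_ite_eq']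
    split_ifs with hi
    · rw [Finset.mem_Icc] at hi
      obtain ⟨j, rfl⟩ := Nat.exists_eq_add_of_le hi.1
      -- The first factor is less than 1 by the hypothesis `h` and `|t k| ≤ D`; the power of `l` is
      -- at most 1.
      have : t (2 + j) * l ^ (2 + j) / t 0 = t (2 + j) * t 0 / t 1 ^ 2 * l ^ j := by
        rw [pow_add, hl]
        field_simp
      rw [this, absVal_mul, absVal_pow, absVal_div, absVal_mul, absVal_pow]
      refine (mul_le_of_le_one_right (div_nonneg (mul_nonneg (absVal_nonneg _) (absVal_nonneg _))
        (by positivity)) (pow_le_one₀ (absVal_nonneg _) hl1)).trans_lt ?_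
      rw [div_lt_one (by positivity)]
      refine lt_of_le_of_lt ?_ h
      rw [mul_comm]
      exact mul_le_mul_of_nonneg_left (htle _) (absVal_nonneg _)
    · rw [absVal_zero]
      exact zero_lt_one
  obtain ⟨y, hy1, hy⟩ := exists_fixed_point hgc
  refine ⟨x + l * y, ?_, ?_⟩
  · have hev : f.eval (x + l * y) = ∑ k ∈ Finset.range (n + 2), t k * (l * y) ^ k := by
      have : f.eval (x + l * y) = (taylor x f).eval (l * y) := by
        rw [taylor_eval, add_comm]
      rw [this, eval_eq_sum_range' (n := n + 2) (by rw [natDegree_taylor]; lia)]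
    have hge : g.eval y = ∑ k ∈ Finset.Icc 2 (n + 1), t k * l ^ k / t 0 * y ^ k := by
      simp only [g, eval_finsetSum, eval_monomial]
    have hsplit : Finset.range (n + 2) = insert 0 (insert 1 (Finset.Icc 2 (n + 1))) := by
      ext i
      simp only [Finset.mem_range, Finset.mem_insert, Finset.mem_Icc]
      lia
    rw [hev, hsplit, Finset.sum_insert (by simp), Finset.sum_insert (by simp)]
    have : ∑ k ∈ Finset.Icc 2 (n + 1), t k * (l * y) ^ k = t 0 * g.eval y := by
      rw [hge, Finset.mul_sum]
      refine Finset.sum_congr rfl fun k _ => ?_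
      rw [mul_pow]
      field_simp
    rw [this]
    have h2 : t 1 * (l * y) ^ 1 = t 0 * y := by
      rw [hl]
      field_simp
    rw [h2]
    linear_combination t 0 * hy
  · rw [← hlabs]
    have : x - (x + l * y) = -(l * y) := by ring
    rw [this, absVal_neg, absVal_mul]
    exact mul_le_of_le_one_right (absVal_nonneg _) hy1

/-- Every element of `F((T⁻¹))` has an integral part. -/
theorem exists_polyEmb_near (x : LaurentSeries F) : ∃ a : F[X], absVal (x - polyEmb F a) < 1 := by
  obtain ⟨N, hN⟩ : ∃ N : ℕ, ∀ j : ℕ, N ≤ j → x.coeff (-(j : ℤ)) = 0 :=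
    ⟨(-x.order).toNat + 1, fun j hj => HahnSeries.coeff_eq_zero_of_lt_order (by lia)⟩
  refine ⟨∑ i ∈ Finset.range N, monomial i (x.coeff (-(i : ℤ))), ?_⟩
  rw [absVal_lt_one_iff, ← zpow_neg_one, absVal_le_zpow_iff]
  intro i hi
  obtain ⟨j, rfl⟩ : ∃ j : ℕ, i = -(j : ℤ) := ⟨i.natAbs, by lia⟩
  rw [HahnSeries.coeff_sub, polyEmb_coeff, finsetSum_coeff]
  simp only [coeff_monomial, Finset.sum_ite_eq', Finset.mem_range]
  split_ifs with h
  · exact sub_self _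
  · rw [sub_zero]
    exact hN j (by lia)

end Evaluation

/-! ### Boxes of polynomials and the pigeonhole principle -/

/-- The polynomial over `F[T]` with given coefficients of degree less than `a`. -/
def boxPoly (F : Type*) [Field F] (d a : ℕ) : (Fin d → degreeLT F a) →ₗ[F] F[X][X] where
  toFun v := ∑ i : Fin d, monomial (i : ℕ) (v i : F[X])
  map_add' v w := by simp [Finset.sum_add_distrib]
  map_smul' c v := by
    simp only [Pi.smul_apply, Submodule.coe_smul, RingHom.id_apply, Finset.smul_sum, smul_monomial]

theorem coeff_boxPoly {d a : ℕ} (v : Fin d → degreeLT F a) (i : Fin d) :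
    (boxPoly F d a v).coeff i = v i := by
  simp [boxPoly, finsetSum_coeff, coeff_monomial, Fin.val_inj]

theorem coeff_boxPoly_of_le {d a : ℕ} (v : Fin d → degreeLT F a) {j : ℕ} (hj : d ≤ j) :
    (boxPoly F d a v).coeff j = 0 := by
  simp only [boxPoly, LinearMap.coe_mk, AddHom.coe_mk, finsetSum_coeff, coeff_monomial]
  exact Finset.sum_eq_zero fun i _ => if_neg (by lia)

theorem degree_boxPoly_lt {d a : ℕ} (v : Fin d → degreeLT F a) :
    (boxPoly F d a v).degree < d :=
  (degree_lt_iff_coeff_zero _ _).2 fun _ => coeff_boxPoly_of_le v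

theorem natDegree_coeff_boxPoly_le {d a : ℕ} (v : Fin d → degreeLT F (a + 1)) (j : ℕ) :
    ((boxPoly F d (a + 1) v).coeff j).natDegree ≤ a := by
  by_cases hj : j < d
  · have := coeff_boxPoly v ⟨j, hj⟩
    simp only at this
    rw [this, natDegree_le_iff_degree_le]
    exact Order.lt_succ_iff.1 (mem_degreeLT.1 (v ⟨j, hj⟩).2)
  · rw [coeff_boxPoly_of_le v (by lia), natDegree_zero]
    exact Nat.zero_le a

theorem boxPoly_eq_zero {d a : ℕ} {v : Fin d → degreeLT F a} (h : boxPoly F d a v = 0) :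
    v = 0 := by
  funext i
  ext1
  rw [← coeff_boxPoly, h]
  simp

theorem finrank_box (d a : ℕ) : Module.finrank F (Fin d → degreeLT F a) = d * a := by
  rw [Module.finrank_pi_fintype, Finset.sum_const, (degreeLTEquiv F a).finrank_eq]
  simp

instance (a : ℕ) : FiniteDimensional F (degreeLT F a) :=
  (degreeLTEquiv F a).symm.finiteDimensional

theorem exists_ne_zero_map_eq_zero {V W : Type*} [AddCommGroup V] [Module F V] [AddCommGroup W]
    [Module F W] [FiniteDimensional F V] [FiniteDimensional F W] (f : V →ₗ[F] W)
    (h : Module.finrank F W < Module.finrank F V) : ∃ v, v ≠ 0 ∧ f v = 0 := by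
  obtain ⟨v, hv, hv0⟩ := (Submodule.ne_bot_iff _).1 (f.ker_ne_bot_of_finrank_lt h)
  exact ⟨v, hv0, hv⟩

/-! ### Dirichlet approximation and Bézout identities with bounded cofactors -/

section Finite

variable [Finite F]

theorem polyEmb_C (c : F) : polyEmb F (C c) = HahnSeries.C c := by simp [polyEmb]

theorem evalAt_smul (c : F) (P : F[X][X]) (ξ : LaurentSeries F) :
    evalAt (c • P) ξ = c • evalAt P ξ := by
  have : c • P = C (C c) * P := by
    ext i j
    simp
  rw [this, evalAt_mul, evalAt_C, polyEmb_C, HahnSeries.C_mul_eq_smul]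

/-- Dirichlet's theorem for the powers of `ξ`. -/
theorem exists_small_value (ξ : LaurentSeries F) (n : ℕ) :
    ∃ C₀ : ℝ, 0 < C₀ ∧ ∀ h : ℕ, ∃ P : F[X][X], P ≠ 0 ∧ P.natDegree ≤ n ∧
      polyHeight P ≤ (Nat.card F : ℝ) ^ h ∧
      absVal (evalAt P ξ) ≤ C₀ * ((Nat.card F : ℝ) ^ h) ^ (-(n : ℤ)) := by
  obtain ⟨e, he⟩ := pow_unbounded_of_one_lt (max 1 (absVal ξ)) (one_lt_card (F := F))
  refine ⟨(Nat.card F : ℝ) ^ (n * e), pow_pos card_pos _, fun h => ?_⟩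
  have hle : ∀ v : Fin (n + 1) → degreeLT F (h + 1), ∀ i < -((h + n * e : ℕ) : ℤ),
      (evalAt (boxPoly F _ _ v) ξ).coeff i = 0 := by
    intro v
    rw [← absVal_le_zpow_iff, neg_neg, zpow_natCast, pow_add, pow_mul']
    have hd : (boxPoly F _ _ v).natDegree ≤ n :=
      natDegree_le_iff_degree_le.2 (Order.lt_succ_iff.1 (degree_boxPoly_lt v))
    refine (absVal_evalAt_le hd ξ).trans ?_
    refine mul_le_mul (polyHeight_le_pow_iff.2 (natDegree_coeff_boxPoly_le v)) ?_ (by positivity)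
      (by positivity)
    exact pow_le_pow_left₀ (by positivity) he.le n
  -- By `hle` all values start at exponent `-(h + n * e)` or later. Killing the next `n * h + h`
  -- coefficients is possible, the box having dimension `(n + 1) * (h + 1)`, and brings the order up
  -- to at least `n * h - n * e`.
  let f : (Fin (n + 1) → degreeLT F (h + 1)) →ₗ[F] (Fin (n * h + h) → F) :=
    { toFun := fun v i => (evalAt (boxPoly F _ _ v) ξ).coeff ((i : ℤ) - (h + n * e : ℕ))
      map_add' := fun v w => by
        funext i
        simp [evalAt_add]
      map_smul' := fun c v => by
        funext i
        simp [evalAt_smul] }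
  obtain ⟨v, hv0, hv⟩ := exists_ne_zero_map_eq_zero f (by
    rw [finrank_box, Module.finrank_fintype_fun_eq_card, Fintype.card_fin]
    nlinarith)
  refine ⟨boxPoly F _ _ v, fun h0 => hv0 (boxPoly_eq_zero h0),
    natDegree_le_iff_degree_le.2 (Order.lt_succ_iff.1 (degree_boxPoly_lt v)),
    polyHeight_le_pow_iff.2 (natDegree_coeff_boxPoly_le v), ?_⟩
  have : (Nat.card F : ℝ) ^ (n * e) * ((Nat.card F : ℝ) ^ h) ^ (-(n : ℤ))
      = (Nat.card F : ℝ) ^ (-((n * h : ℕ) - (n * e : ℕ) : ℤ)) := by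
    rw [← zpow_natCast, ← zpow_natCast, ← zpow_mul, ← zpow_add₀ card_pos.ne']
    congr 1
    push_cast
    ring
  rw [this, absVal_le_zpow_iff]
  intro i hi
  by_cases hi' : i < -((h + n * e : ℕ) : ℤ)
  · exact hle v i hi'
  · have := congrFun hv ⟨(i + (h + n * e : ℕ)).toNat, by push_cast at *; lia⟩
    simp only [f, LinearMap.coe_mk, AddHom.coe_mk, Pi.zero_apply] at this
    rwa [show (((i + (h + n * e : ℕ)).toNat : ℕ) : ℤ) - (h + n * e : ℕ) = i by lia] at this

/-- A nonzero constant in the ideal generated by an irreducible `M` and a polynomial `Q` that `M`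
does not divide, with control on the cofactors. -/
theorem exists_mul_add_mul_eq_C {M Q : F[X][X]} (hM : Irreducible M) (hQ : ¬ M ∣ Q) {n m h : ℕ}
    (hd : 0 < M.natDegree)
    (hn : Q.natDegree ≤ n) (hm : polyHeight M ≤ (Nat.card F : ℝ) ^ m)
    (hh : polyHeight Q ≤ (Nat.card F : ℝ) ^ h) :
    ∃ A B : F[X][X], ∃ c : F[X], A * Q + B * M = C c ∧ c ≠ 0 ∧ A.natDegree ≤ M.natDegree ∧
      B.natDegree ≤ n ∧
      polyHeight A ≤ (Nat.card F : ℝ) ^ ((M.natDegree - 1) * h + (M.natDegree + n) * m) ∧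
      polyHeight B ≤ (Nat.card F : ℝ) ^ (M.natDegree * h + (M.natDegree + n) * m) := by
  set d := M.natDegree with hdd
  -- Chosen for a dimension count: `d * (a + 1) + n * (a + h + 1)` unknowns exceed the `(d + n - 1)
  -- * (a + h + m + 1)` equations, by `m + 1`.
  set a := (d - 1) * h + (d + n) * m with ha
  have ha' : d * h + (d + n) * m = a + h := by
    obtain ⟨d', hd'⟩ : ∃ d', d = d' + 1 := ⟨d - 1, by lia⟩
    rw [ha, hd', Nat.add_sub_cancel]
    ring
  rw [ha']
  let g : ((Fin d → degreeLT F (a + 1)) × (Fin n → degreeLT F (a + h + 1))) →ₗ[F] F[X][X] :=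
    { toFun := fun v => boxPoly F _ _ v.1 * Q + boxPoly F _ _ v.2 * M
      map_add' := fun v w => by simp only [Prod.fst_add, Prod.snd_add, map_add]; ring
      map_smul' := fun c v => by
        simp only [Prod.smul_fst, Prod.smul_snd, map_smul, smul_mul_assoc, smul_add,
          RingHom.id_apply] }
  have hA : ∀ v : (Fin d → degreeLT F (a + 1)) × (Fin n → degreeLT F (a + h + 1)),
      polyHeight (boxPoly F _ _ v.1) ≤ (Nat.card F : ℝ) ^ a := fun v =>
    polyHeight_le_pow_iff.2 (natDegree_coeff_boxPoly_le v.1)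
  have hB : ∀ v : (Fin d → degreeLT F (a + 1)) × (Fin n → degreeLT F (a + h + 1)),
      polyHeight (boxPoly F _ _ v.2) ≤ (Nat.card F : ℝ) ^ (a + h) := fun v =>
    polyHeight_le_pow_iff.2 (natDegree_coeff_boxPoly_le v.2)
  have hgh : ∀ v, polyHeight (g v) ≤ (Nat.card F : ℝ) ^ (a + h + m) := by
    intro v
    refine (polyHeight_add_le _ _).trans (max_le ?_ ?_)
    · rw [polyHeight_mul]
      refine (mul_le_mul (hA v) hh (polyHeight_nonneg _) (by positivity)).trans ?_
      rw [← pow_add]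
      exact pow_le_pow_right₀ one_lt_card.le (by lia)
    · rw [polyHeight_mul, pow_add]
      exact mul_le_mul (hB v) hm (polyHeight_nonneg _) (by positivity)
  have hgd : ∀ v, (g v).degree < ((d + n : ℕ) : WithBot ℕ) := by
    intro v
    refine (degree_add_le _ _).trans_lt (max_lt ?_ ?_)
    · by_cases h0 : boxPoly F _ _ v.1 = 0
      · rw [h0, zero_mul, degree_zero]
        exact WithBot.bot_lt_coe _
      · have h1 := degree_boxPoly_lt v.1
        rw [degree_eq_natDegree h0, Nat.cast_lt] at h1
        refine (degree_le_natDegree.trans (Nat.cast_le.2 natDegree_mul_le)).trans_lt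
          (Nat.cast_lt.2 (by lia))
    · by_cases h0 : boxPoly F _ _ v.2 = 0
      · rw [h0, zero_mul, degree_zero]
        exact WithBot.bot_lt_coe _
      · have h1 := degree_boxPoly_lt v.2
        rw [degree_eq_natDegree h0, Nat.cast_lt] at h1
        refine (degree_le_natDegree.trans (Nat.cast_le.2 natDegree_mul_le)).trans_lt
          (Nat.cast_lt.2 (by lia))
  -- The conditions annihilate the coefficients of `X ^ 1, …, X ^ (d + n - 1)` in `A * Q + B * M`;
  -- only a constant in `X` survives.
  let f : ((Fin d → degreeLT F (a + 1)) × (Fin n → degreeLT F (a + h + 1))) →ₗ[F]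
      (Fin (d + n - 1) → degreeLT F (a + h + m + 1)) :=
    { toFun := fun v i => ⟨(g v).coeff (i + 1), mem_degreeLT.2
        (Order.lt_succ_iff.2 (natDegree_le_iff_degree_le.1 (polyHeight_le_pow_iff.1 (hgh v) _)))⟩
      map_add' := fun v w => by
        funext i
        ext1
        simp [-LinearMap.coe_mk]
      map_smul' := fun c v => by
        funext i
        ext1
        simp [-LinearMap.coe_mk] }
  obtain ⟨v, hv0, hv⟩ := exists_ne_zero_map_eq_zero f (by
    rw [finrank_box, Module.finrank_prod, finrank_box, finrank_box]
    obtain ⟨d', hd'⟩ : ∃ d', d = d' + 1 := ⟨d - 1, by lia⟩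
    rw [ha, hd', Nat.add_sub_cancel, show d' + 1 + n - 1 = d' + n by lia]
    nlinarith)
  have hgC : g v = C ((g v).coeff 0) := by
    ext1 i
    rcases i with _ | i
    · simp
    rw [coeff_C_succ]
    by_cases hi : i < d + n - 1
    · exact congrArg Subtype.val (congrFun hv ⟨i, hi⟩)
    · exact coeff_eq_zero_of_degree_lt ((hgd v).trans_le (Nat.cast_le.2 (by lia)))
  refine ⟨boxPoly F _ _ v.1, boxPoly F _ _ v.2, (g v).coeff 0, hgC, fun hc => hv0 ?_,
    natDegree_le_iff_degree_le.2 (degree_boxPoly_lt v.1).le,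
    natDegree_le_iff_degree_le.2 (degree_boxPoly_lt v.2).le, hA v, hB v⟩
  -- If the constant were 0, the prime `M` would divide `A`, whose degree is less than that of `M`;
  -- then `A = 0` and `B = 0`.
  have hg0 : boxPoly F _ _ v.1 * Q + boxPoly F _ _ v.2 * M = 0 := by
    rw [hc, C_0] at hgC
    exact hgC
  have hdvd : M ∣ boxPoly F _ _ v.1 * Q :=
    (dvd_add_left (Dvd.intro_left _ rfl)).1 (hg0 ▸ dvd_zero M)
  have h1 : boxPoly F _ _ v.1 = 0 := by
    have h2 := (hM.prime.dvd_or_dvd hdvd).resolve_right hQ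
    by_contra h0
    have h3 := degree_le_of_dvd h2 h0
    rw [degree_eq_natDegree hM.ne_zero] at h3
    exact (h3.trans_lt (degree_boxPoly_lt v.1)).ne rfl
  rw [h1, zero_mul, zero_add] at hg0
  have h2 := (mul_eq_zero.1 hg0).resolve_right hM.ne_zero
  exact Prod.ext (boxPoly_eq_zero h1) (boxPoly_eq_zero h2)

end Finite

/-! ### Reduction to separable irreducible polynomials -/

theorem coeff_pow_char {R : Type*} [CommRing R] (p : ℕ) [hp : Fact p.Prime] [CharP R p] (f : R[X])
    (m : ℕ) : (f ^ p).coeff m = if p ∣ m then f.coeff (m / p) ^ p else 0 := by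
  rw [← map_frobenius_expand p f, coeff_map, coeff_expand hp.out.pos]
  split_ifs
  · rfl
  · exact map_zero _

section Finite

variable [Finite F] (p : ℕ) [hp : Fact p.Prime] [CharP F p]

/-- The polynomials `b` in the decomposition `a = ∑ j < p, T ^ j * b j ^ p`. -/
def pthPart (j : ℕ) (a : F[X]) : F[X] :=
  ∑ k ∈ Finset.range (a.natDegree + 1),
    monomial k ((frobeniusEquiv F p).symm (a.coeff (p * k + j)))

theorem coeff_pthPart (j : ℕ) (a : F[X]) (k : ℕ) :
    (pthPart p j a).coeff k = (frobeniusEquiv F p).symm (a.coeff (p * k + j)) := by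
  simp only [pthPart, finsetSum_coeff, coeff_monomial, Finset.sum_ite_eq', Finset.mem_range]
  split_ifs with h
  · rfl
  · have := hp.out.pos
    rw [coeff_eq_zero_of_natDegree_lt (by nlinarith), map_zero]

theorem pthPart_zero (j : ℕ) : pthPart p j (0 : F[X]) = 0 := by
  ext k
  simp [coeff_pthPart]

/-- Only the index `j = m % p` contributes to the coefficient of `T ^ m`, and coefficients have
`p`-th roots because Frobenius is bijective on `F`. -/
theorem sum_pthPart (a : F[X]) : ∑ j ∈ Finset.range p, X ^ j * pthPart p j a ^ p = a := by
  ext m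
  have hp0 := hp.out.pos
  rw [finsetSum_coeff, Finset.sum_eq_single (m % p)]
  · rw [coeff_X_pow_mul', if_pos (Nat.mod_le m p), coeff_pow_char, if_pos (Nat.dvd_sub_mod m),
      coeff_pthPart, Nat.mul_div_cancel' (Nat.dvd_sub_mod m), Nat.sub_add_cancel (Nat.mod_le m p)]
    exact (frobeniusEquiv F p).apply_symm_apply _
  · intro j hj hne
    rw [coeff_X_pow_mul']
    split_ifs with h
    · rw [coeff_pow_char, if_neg]
      intro hdvd
      apply hne
      rw [Finset.mem_range] at hj
      obtain ⟨c, hc⟩ := hdvd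
      have : m = j + p * c := by lia
      rw [this, Nat.add_mul_mod_self_left, Nat.mod_eq_of_lt hj]
    · rfl
  · intro h
    exact absurd (Finset.mem_range.2 (Nat.mod_lt m hp0)) h

theorem absVal_pthPart_pow_le (j : ℕ) (a : F[X]) :
    absVal (polyEmb F (pthPart p j a)) ^ p ≤ absVal (polyEmb F a) := by
  by_cases h : pthPart p j a = 0
  · rw [h, map_zero, absVal_zero, zero_pow hp.out.ne_zero]
    exact absVal_nonneg _
  have hc : a.coeff (p * (pthPart p j a).natDegree + j) ≠ 0 := fun h0 => by
    have := coeff_pthPart p j a (pthPart p j a).natDegree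
    rw [h0, map_zero, coeff_natDegree, leadingCoeff_eq_zero] at this
    exact h this
  have ha : a ≠ 0 := fun h0 => hc (by rw [h0, coeff_zero])
  rw [absVal_polyEmb h, absVal_polyEmb ha, ← pow_mul']
  exact pow_le_pow_right₀ one_lt_card.le (by have := le_natDegree_of_ne_zero hc; lia)

theorem exists_coeff_eq_polyHeight (P : F[X][X]) :
    ∃ i, polyHeight P = absVal (polyEmb F (P.coeff i)) := by
  obtain ⟨i, hi⟩ := exists_eq_gaussNorm (polyAbs F) 1 P
  exact ⟨i, by rw [polyHeight_eq_gaussNorm, hi, one_pow, mul_one, polyAbs_apply]⟩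

/-- A polynomial with vanishing derivative is a combination of `p`-th powers with coefficients
`1, T, …, T ^ (p - 1)`. -/
theorem exists_eq_sum_pow_of_derivative_eq_zero {P : F[X][X]} (hP : derivative P = 0) :
    ∃ Q : ℕ → F[X][X], P = ∑ j ∈ Finset.range p, C (X ^ j) * Q j ^ p ∧
      ∀ j, p * (Q j).natDegree ≤ P.natDegree ∧ polyHeight (Q j) ^ p ≤ polyHeight P := by
  have hp0 := hp.out.pos
  -- Vanishing of the derivative makes `P` a polynomial in `X ^ p`; it remains to split each
  -- coefficient with `pthPart`.
  let R := contract p P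
  have hR : expand F[X] p R = P := expand_contract p hP hp0.ne'
  let Q : ℕ → F[X][X] := fun j =>
    ∑ i ∈ Finset.range (R.natDegree + 1), monomial i (pthPart p j (R.coeff i))
  have hQ : ∀ j i, (Q j).coeff i = pthPart p j (P.coeff (p * i)) := by
    intro j i
    have hRi : R.coeff i = P.coeff (p * i) := by
      rw [coeff_contract hp0.ne', mul_comm]
    rw [← hRi]
    simp only [Q, finsetSum_coeff, coeff_monomial, Finset.sum_ite_eq', Finset.mem_range]
    split_ifs with h
    · rfl
    · rw [coeff_eq_zero_of_natDegree_lt (by lia), pthPart_zero]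
  refine ⟨Q, ?_, fun j => ⟨?_, ?_⟩⟩
  · ext1 m
    simp only [finsetSum_coeff, coeff_C_mul, coeff_pow_char]
    by_cases h : p ∣ m
    · obtain ⟨i, rfl⟩ := h
      simp only [dvd_mul_right, if_true, Nat.mul_div_cancel_left i hp0, hQ, sum_pthPart]
    · simp only [h, if_false, mul_zero, Finset.sum_const_zero]
      rw [← hR, coeff_expand hp0, if_neg h]
  · by_cases h0 : Q j = 0
    · simp [h0]
    · apply le_natDegree_of_ne_zero
      intro h
      have := hQ j (Q j).natDegree
      rw [h, pthPart_zero, coeff_natDegree, leadingCoeff_eq_zero] at this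
      exact h0 this
  · obtain ⟨i, hi⟩ := exists_coeff_eq_polyHeight (Q j)
    rw [hi, hQ]
    exact (absVal_pthPart_pow_le p j _).trans (absVal_coeff_le_polyHeight P _)

theorem polyEmb_X : polyEmb F X = HahnSeries.single (-1 : ℤ) (1 : F) := by simp [polyEmb]

/-- The terms of a sum `∑ j < p, T ^ j * x j ^ p` have different absolute values. -/
theorem exists_pow_le_absVal_sum (x : ℕ → LaurentSeries F)
    (h : ∑ j ∈ Finset.range p, polyEmb F (X ^ j) * x j ^ p ≠ 0) :
    ∃ j ∈ Finset.range p, x j ≠ 0 ∧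
      absVal (x j) ^ p ≤ absVal (∑ j ∈ Finset.range p, polyEmb F (X ^ j) * x j ^ p) := by
  have hp0 := hp.out.pos
  set y : ℕ → LaurentSeries F := fun j => polyEmb F (X ^ j) * x j ^ p with hy
  have hX : polyEmb F X ≠ 0 := (map_ne_zero_iff _ polyEmb_injective).2 X_ne_zero
  obtain ⟨j, hj, hmax⟩ := Finset.exists_max_image (Finset.range p) (fun j => absVal (y j))
    ⟨0, Finset.mem_range.2 hp0⟩
  have hyj : y j ≠ 0 := fun h0 => by
    apply h
    refine Finset.sum_eq_zero fun i hi => ?_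
    have := hmax i hi
    rw [h0, absVal_zero] at this
    exact absVal_eq_zero.1 (le_antisymm this (absVal_nonneg _))
  have hxj : ∀ i, y i ≠ 0 → x i ≠ 0 := fun i hi h0 => hi (by
    simp only [hy, h0, zero_pow hp0.ne', mul_zero])
  -- The order of the `i`-th term is `-i` modulo `p`, so nonzero terms with different `i < p` have
  -- different orders and the largest one determines the absolute value of the sum.
  have hord : ∀ i, y i ≠ 0 → (y i).order = p * (x i).order - i := by
    intro i hi
    simp only [hy, map_pow]
    rw [HahnSeries.order_mul (pow_ne_zero _ hX) (pow_ne_zero _ (hxj i hi)), HahnSeries.order_pow,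
      HahnSeries.order_pow, polyEmb_X, HahnSeries.order_single one_ne_zero]
    simp
    ring
  have hsum : absVal (∑ i ∈ Finset.range p, y i) = absVal (y j) := by
    refine IsNonarchimedean.apply_sum_eq_of_lt (f := absValue F) isNonarchimedean_absValue
      (fun x => ((absValue F).map_neg x).symm) hj fun i hi hij => ?_
    refine lt_of_le_of_ne (hmax i hi) fun heq => hij ?_
    have hyi : y i ≠ 0 := absVal_pos_iff.1 (by
      simp only [absValue_apply] at heq
      rw [heq]
      exact absVal_pos hyj)
    simp only [absValue_apply] at heq
    rw [absVal_of_ne_zero hyi, absVal_of_ne_zero hyj,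
      zpow_right_inj₀ card_pos one_lt_card.ne', hord i hyi, hord j hyj] at heq
    rw [Finset.mem_range] at hi hj
    have hmod : (i : ℤ) ≡ j [ZMOD p] := by
      rw [Int.modEq_iff_dvd]
      exact ⟨(x j).order - (x i).order, by linarith⟩
    rw [Int.natCast_modEq_iff] at hmod
    exact Nat.ModEq.eq_of_lt_of_lt hmod hi hj
  refine ⟨j, hj, hxj j hyj, ?_⟩
  rw [hsum]
  simp only [hy, absVal_mul, absVal_pow]
  exact le_mul_of_one_le_left (pow_nonneg (absVal_nonneg _) _)
    (one_le_absVal_polyEmb (pow_ne_zero _ X_ne_zero))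

theorem evalAt_sum {ι : Type*} (s : Finset ι) (f : ι → F[X][X]) (ξ : LaurentSeries F) :
    evalAt (∑ i ∈ s, f i) ξ = ∑ i ∈ s, evalAt (f i) ξ := eval₂_finsetSum _ _ _ _

theorem evalAt_pow (P : F[X][X]) (k : ℕ) (ξ : LaurentSeries F) :
    evalAt (P ^ k) ξ = evalAt P ξ ^ k := eval₂_pow _ _ _

/-- A polynomial with vanishing derivative takes at `ξ` a value that is bounded below by the
`p`-th power of the value of a polynomial of smaller degree and height. -/
theorem exists_pth_root {P : F[X][X]} (hP : derivative P = 0) {ξ : LaurentSeries F}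
    (hξ : evalAt P ξ ≠ 0) : ∃ Q : F[X][X], evalAt Q ξ ≠ 0 ∧ p * Q.natDegree ≤ P.natDegree ∧
      polyHeight Q ^ p ≤ polyHeight P ∧ absVal (evalAt Q ξ) ^ p ≤ absVal (evalAt P ξ) := by
  obtain ⟨Q, hPQ, hQ⟩ := exists_eq_sum_pow_of_derivative_eq_zero p hP
  have hev : evalAt P ξ = ∑ j ∈ Finset.range p, polyEmb F (X ^ j) * evalAt (Q j) ξ ^ p := by
    conv_lhs => rw [hPQ]
    rw [evalAt_sum]
    exact Finset.sum_congr rfl fun j _ => by rw [evalAt_mul, evalAt_C, evalAt_pow]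
  rw [hev] at hξ ⊢
  obtain ⟨j, -, hj0, hj⟩ := exists_pow_le_absVal_sum p (fun j => evalAt (Q j) ξ) hξ
  exact ⟨Q j, hj0, (hQ j).1, (hQ j).2, hj⟩

end Finite

/-- Used throughout to absorb a constant into an arbitrarily small power of a large height. -/
theorem exists_forall_lt_rpow (K : ℝ) {s : ℝ} (hs : 0 < s) :
    ∃ B : ℝ, 1 ≤ B ∧ ∀ H : ℝ, B < H → K < H ^ s := by
  obtain ⟨B, hB⟩ := Filter.eventually_atTop.1 ((tendsto_rpow_atTop hs).eventually_gt_atTop K)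
  exact ⟨max 1 B, le_max_left _ _, fun H hH => hB H ((le_max_right _ _).trans hH.le)⟩

theorem exists_pos_le_of_finite {α : Type*} {S : Set α} (hS : S.Finite) (f : α → ℝ)
    (hf : ∀ x ∈ S, 0 < f x) : ∃ δ : ℝ, 0 < δ ∧ δ ≤ 1 ∧ ∀ x ∈ S, δ ≤ f x := by
  rcases S.eq_empty_or_nonempty with rfl | hne
  · exact ⟨1, one_pos, le_rfl, by simp⟩
  · obtain ⟨a, ha, hmin⟩ := Set.exists_min_image S f hS hne
    exact ⟨min 1 (f a), lt_min one_pos (hf a ha), min_le_left _ _,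
      fun x hx => (min_le_right _ _).trans (hmin x hx)⟩

theorem exists_polyHeight_gt_of_infinite [Finite F] {S : Set F[X][X]} (hS : S.Infinite) {n : ℕ}
    (hn : ∀ P ∈ S, P.natDegree ≤ n) (B : ℝ) : ∃ P ∈ S, B < polyHeight P := by
  by_contra! h
  exact hS ((finite_setOf_polyHeight_le n B).subset fun P hP => ⟨hn P hP, h P hP⟩)

theorem ne_zero_of_evalAt_ne_zero {P : F[X][X]} {ξ : LaurentSeries F} (h : evalAt P ξ ≠ 0) :
    P ≠ 0 := fun h0 => h (by rw [h0, evalAt, eval₂_zero])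

section Finite

variable [Finite F]

/-- A lower bound for the values at `ξ` of the separable irreducible polynomials implies one for
the values of all polynomials. -/
theorem lower_bound_of_separable {ξ : LaurentSeries F} {w δ : ℝ} (hw : 0 ≤ w) (hδ0 : 0 < δ)
    (hδ1 : δ ≤ 1) {n : ℕ}
    (H : ∀ P : F[X][X], Irreducible P → derivative P ≠ 0 → P.natDegree ≤ n → evalAt P ξ ≠ 0 →
      δ * polyHeight P ^ (-w) ≤ absVal (evalAt P ξ))
    (P : F[X][X]) (hPn : P.natDegree ≤ n) (hP : evalAt P ξ ≠ 0) :
    δ ^ P.natDegree * polyHeight P ^ (-w) ≤ absVal (evalAt P ξ) := by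
  obtain ⟨p, hchar⟩ := CharP.exists F
  have : Fact p.Prime := ⟨CharP.char_is_prime F p⟩
  have hp2 : 2 ≤ p := (Fact.out : p.Prime).two_le
  have hrp : ∀ P : F[X][X], 0 ≤ polyHeight P ^ (-w) := fun P =>
    Real.rpow_nonneg (polyHeight_nonneg P) _
  -- The bound is multiplicative in `P`, the exponent of `δ` being the degree, so it passes from
  -- factors to products. It also survives `p`-th powers, since the `Q` of `exists_pth_root`
  -- satisfies `p * deg Q ≤ deg P`.
  suffices key : ∀ m, m ≤ n → ∀ P : F[X][X], P.natDegree ≤ m → evalAt P ξ ≠ 0 →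
      δ ^ P.natDegree * polyHeight P ^ (-w) ≤ absVal (evalAt P ξ) from
    key n le_rfl P hPn hP
  intro m
  induction m using Nat.strong_induction_on with
  | _ m ih =>
  intro hmn
  have hconst : ∀ P : F[X][X], P.natDegree = 0 → evalAt P ξ ≠ 0 →
      δ ^ P.natDegree * polyHeight P ^ (-w) ≤ absVal (evalAt P ξ) := by
    intro P h0 hP
    have hP0 := ne_zero_of_evalAt_ne_zero hP
    rw [h0, pow_zero, one_mul]
    refine (Real.rpow_le_one_of_one_le_of_nonpos (one_le_polyHeight hP0) (by linarith)).trans ?_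
    rw [eq_C_of_natDegree_eq_zero h0, evalAt_C]
    rw [eq_C_of_natDegree_eq_zero h0] at hP0
    exact one_le_absVal_polyEmb fun h => hP0 (by rw [h, C_0])
  have hirr : ∀ P : F[X][X], Irreducible P → P.natDegree ≤ m → evalAt P ξ ≠ 0 →
      δ ^ P.natDegree * polyHeight P ^ (-w) ≤ absVal (evalAt P ξ) := by
    intro P hPi hPm hP
    by_cases h0 : P.natDegree = 0
    · exact hconst P h0 hP
    by_cases hd : derivative P = 0
    · obtain ⟨Q, hQ0, hQd, hQh, hQv⟩ := exists_pth_root p hd hP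
      have hQlt : Q.natDegree < m := by nlinarith [Nat.pos_of_ne_zero h0]
      have hQ := ih Q.natDegree hQlt (hQlt.le.trans hmn) Q le_rfl hQ0
      have hQpos := polyHeight_pos (ne_zero_of_evalAt_ne_zero hQ0)
      refine le_trans ?_ hQv
      refine le_trans ?_ (pow_le_pow_left₀ (mul_nonneg (by positivity) (hrp Q)) hQ p)
      rw [mul_pow, ← pow_mul]
      refine mul_le_mul (pow_le_pow_of_le_one hδ0.le hδ1 (by rwa [mul_comm])) ?_ (hrp P)
        (by positivity)
      rw [← Real.rpow_natCast, ← Real.rpow_mul hQpos.le, mul_comm, Real.rpow_mul hQpos.le,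
        Real.rpow_natCast]
      exact Real.rpow_le_rpow_of_nonpos (by positivity) hQh (by linarith)
    · refine le_trans (mul_le_mul_of_nonneg_right ?_ (hrp P)) (H P hPi hd (hPm.trans hmn) hP)
      exact pow_le_of_le_one hδ0.le hδ1 h0
  intro P
  induction P using WfDvdMonoid.induction_on_irreducible with
  | zero => exact fun _ h => absurd rfl (ne_zero_of_evalAt_ne_zero h)
  | unit u hu => exact fun _ h => hconst u (natDegree_eq_zero_of_isUnit hu) h
  | mul a i ha hi iha =>
    intro hm hP
    rw [evalAt_mul] at hP ⊢
    rw [natDegree_mul hi.ne_zero ha] at hm ⊢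
    rw [polyHeight_mul, absVal_mul, Real.mul_rpow (polyHeight_nonneg _) (polyHeight_nonneg _),
      pow_add, mul_mul_mul_comm]
    exact mul_le_mul (hirr i hi (by lia) (left_ne_zero_of_mul hP))
      (iha (by lia) (right_ne_zero_of_mul hP)) (mul_nonneg (by positivity) (hrp a))
      (absVal_nonneg _)

/-- In the definition of `wExp` one may restrict to separable irreducible polynomials. -/
theorem exists_separable_irreducible {ξ : LaurentSeries F} {n : ℕ} {w w' : ℝ} (hw' : 0 ≤ w')
    (hww : w' < w)
    (hinf : {P : F[X][X] | P.natDegree ≤ n ∧ 0 < absVal (evalAt P ξ) ∧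
      absVal (evalAt P ξ) < polyHeight P ^ (-w)}.Infinite) (B : ℝ) :
    ∃ P : F[X][X], Irreducible P ∧ derivative P ≠ 0 ∧ P.natDegree ≤ n ∧ B < polyHeight P ∧
      0 < absVal (evalAt P ξ) ∧ absVal (evalAt P ξ) < polyHeight P ^ (-w') := by
  by_contra! hcon
  -- `δ` handles the finitely many polynomials of height at most `B`; above `B` the negated claim is
  -- already a lower bound. The resulting bound for all polynomials contradicts `hinf`, because `w'
  -- < w`.
  obtain ⟨δ, hδ0, hδ1, hδ⟩ := exists_pos_le_of_finite
    ((finite_setOf_polyHeight_le (F := F) n B).inter_of_left {P | evalAt P ξ ≠ 0})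
    (fun P => absVal (evalAt P ξ)) fun P hP => absVal_pos hP.2
  have hlow := lower_bound_of_separable (ξ := ξ) hw' hδ0 hδ1 (n := n) fun P hi hd hn hP => by
    have hH := Real.rpow_nonneg (polyHeight_nonneg P) (-w')
    by_cases hB : B < polyHeight P
    · exact (mul_le_of_le_one_left hH hδ1).trans (hcon P hi hd hn hB (absVal_pos hP))
    · refine le_trans (mul_le_of_le_one_right hδ0.le ?_) (hδ P ⟨⟨hn, not_lt.1 hB⟩, hP⟩)
      exact Real.rpow_le_one_of_one_le_of_nonpos (one_le_polyHeight hi.ne_zero) (by linarith)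
  obtain ⟨B', hB'1, hB'⟩ := exists_forall_lt_rpow (δ ^ n)⁻¹ (sub_pos.2 hww)
  obtain ⟨P, ⟨hPn, hP0, hP⟩, hPB⟩ := exists_polyHeight_gt_of_infinite hinf (fun P hP => hP.1) B'
  have hpos : 0 < polyHeight P := by linarith
  have h1 := hlow P hPn (absVal_pos_iff.1 hP0)
  have h2 : δ ^ n * polyHeight P ^ (-w') < polyHeight P ^ (-w) :=
    (mul_le_mul_of_nonneg_right (pow_le_pow_of_le_one hδ0.le hδ1 hPn)
      (Real.rpow_nonneg hpos.le _)).trans_lt (h1.trans_lt hP)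
  have h3 := hB' _ hPB
  rw [inv_lt_iff_one_lt_mul₀ (by positivity)] at h3
  have h4 : polyHeight P ^ (-w') = polyHeight P ^ (w - w') * polyHeight P ^ (-w) := by
    rw [← Real.rpow_add hpos]
    ring_nf
  rw [h4, ← mul_assoc] at h2
  have h5 := Real.rpow_pos_of_pos hpos (-w)
  nlinarith

end Finite

/-! ### Comparison of the exponents -/

/-- Any nonzero polynomial vanishing at `α` thus bounds the degree and height of `α`, as both can
only drop on passing to a divisor. -/
theorem exists_isMinDefPoly_dvd {R : F[X][X]} (hR : R ≠ 0) {α : LaurentSeries F}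
    (hα : evalAt R α = 0) : ∃ P, IsMinDefPoly P α ∧ P ∣ R := by
  induction R using WfDvdMonoid.induction_on_irreducible with
  | zero => exact absurd rfl hR
  | unit u hu => exact absurd hα (hu.map (eval₂RingHom (polyEmb F) α)).ne_zero
  | mul a i ha hi iha =>
    rcases mul_eq_zero.1 ((eval₂_mul (polyEmb F) α).symm.trans hα) with h | h
    · exact ⟨i, ⟨hi, h⟩, dvd_mul_right _ _⟩
    · obtain ⟨P, hP, hd⟩ := iha ha h
      exact ⟨P, hP, hd.mul_left _⟩

theorem finite_setOf_evalAt_eq_zero {P : F[X][X]} (hP : P ≠ 0) :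
    {α : LaurentSeries F | evalAt P α = 0}.Finite := by
  have h := (Polynomial.map_ne_zero_iff polyEmb_injective).2 hP
  refine (P.map (polyEmb F)).rootSet_finite (LaurentSeries F) |>.subset fun α hα => ?_
  rw [mem_rootSet]
  refine ⟨h, ?_⟩
  rw [coe_aeval_eq_eval, eval_map]
  exact hα

section Finite

variable [Finite F]

theorem infinite_of_forall_exists_polyHeight_gt {S : Set F[X][X]}
    (h : ∀ B : ℝ, ∃ P ∈ S, B < polyHeight P) : S.Infinite := by
  intro hfin
  obtain ⟨B, hB⟩ := (hfin.image polyHeight).bddAbove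
  obtain ⟨P, hP, hPB⟩ := h B
  exact hPB.not_ge (hB ⟨P, hP, rfl⟩)

theorem infinite_of_forall_exists_absVal_lt {α : Type*} {S : Set α} (f : α → LaurentSeries F)
    (h : ∀ ε : ℝ, 0 < ε → ∃ x ∈ S, f x ≠ 0 ∧ absVal (f x) < ε) : S.Infinite := by
  intro hfin
  obtain ⟨δ, hδ0, -, hδ⟩ := exists_pos_le_of_finite (hfin.inter_of_left {x | f x ≠ 0})
    (fun x => absVal (f x)) fun x hx => absVal_pos hx.2
  obtain ⟨x, hx, hx0, hxδ⟩ := h δ hδ0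
  exact hxδ.not_ge (hδ x ⟨hx, hx0⟩)

/-- A criterion for lower bounds of `wStarExp`. -/
theorem le_wStarExp {ξ : LaurentSeries F} {n : ℕ} {K t : ℝ} (hK : 1 ≤ K) (ht : -1 < t)
    (h : ∀ B : ℝ, ∃ (R : F[X][X]) (α : LaurentSeries F) (H : ℝ), B < H ∧ R ≠ 0 ∧
      R.natDegree ≤ n ∧ polyHeight R ≤ K * H ∧ evalAt R α = 0 ∧ ξ ≠ α ∧
      absVal (ξ - α) ≤ K * H ^ (-t - 1)) : (t : EReal) ≤ wStarExp ξ n := by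
  refine le_of_forall_lt fun c hc => ?_
  obtain ⟨w, hcw, hwt⟩ := EReal.lt_iff_exists_real_btwn.1
    (max_lt hc (EReal.coe_lt_coe_iff.2 ht) : max c ((-1 : ℝ) : EReal) < t)
  rw [EReal.coe_lt_coe_iff] at hwt
  have hw1 : -1 < w := EReal.coe_lt_coe_iff.1 ((le_max_right _ _).trans_lt hcw)
  refine ((le_max_left _ _).trans_lt hcw).trans_le (le_sSup ⟨w, ?_, rfl⟩)
  refine infinite_of_forall_exists_absVal_lt (fun α => ξ - α) fun ε hε => ?_
  -- One factor `K` comes from the distance and `K ^ (w + 1)` from the height bound `K * H`. The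
  -- bound `B₂` makes the distance less than `ε`, which yields infinitely many `α`.
  obtain ⟨B₁, hB₁, hB₁'⟩ := exists_forall_lt_rpow (K ^ (w + 2)) (sub_pos.2 hwt)
  obtain ⟨B₂, -, hB₂'⟩ := exists_forall_lt_rpow (K / ε) (by linarith : 0 < t + 1)
  obtain ⟨R, α, H, hH, hR0, hRn, hRH, hRα, hξα, hle⟩ := h (max B₁ B₂)
  have hH1 := hB₁' H ((le_max_left _ _).trans_lt hH)
  have hH2 := hB₂' H ((le_max_right _ _).trans_lt hH)
  have hHpos : 0 < H := by linarith [(le_max_left B₁ B₂).trans_lt hH]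
  obtain ⟨P, hP, hPR⟩ := exists_isMinDefPoly_dvd hR0 hRα
  have hKpos : 0 < K := by linarith
  have hsub := sub_ne_zero.2 hξα
  refine ⟨α, ⟨P, hP, (natDegree_le_of_dvd hPR hR0).trans hRn, absVal_pos hsub, ?_⟩, hsub, ?_⟩
  · have hPH : polyHeight P ≤ K * H := (polyHeight_le_of_dvd hPR hR0).trans hRH
    refine hle.trans_lt (lt_of_lt_of_le ?_ (Real.rpow_le_rpow_of_nonpos (polyHeight_pos hP.1.ne_zero)
      hPH (by linarith)))
    rw [Real.mul_rpow hKpos.le hHpos.le]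
    have e1 : H ^ (-w - 1) = H ^ (t - w) * H ^ (-t - 1) := by
      rw [← Real.rpow_add hHpos]
      ring_nf
    have e2 : K = K ^ (-w - 1) * K ^ (w + 2) := by
      rw [← Real.rpow_add hKpos]
      ring_nf
      simp
    rw [e1]
    have h3 := Real.rpow_pos_of_pos hHpos (-t - 1)
    have h4 := Real.rpow_pos_of_pos hKpos (-w - 1)
    calc K * H ^ (-t - 1) = K ^ (-w - 1) * K ^ (w + 2) * H ^ (-t - 1) := by rw [← e2]
      _ < K ^ (-w - 1) * H ^ (t - w) * H ^ (-t - 1) := by gcongr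
      _ = _ := by ring
  · refine hle.trans_lt ?_
    rw [show -t - 1 = -(t + 1) by ring, Real.rpow_neg hHpos.le, ← div_eq_mul_inv,
      div_lt_iff₀ (Real.rpow_pos_of_pos hHpos _)]
    rwa [div_lt_iff₀ hε, mul_comm] at hH2

/-- A criterion for lower bounds of `wExp`. -/
theorem le_wExp {ξ : LaurentSeries F} {n : ℕ} {w : ℝ}
    (h : ∀ B : ℝ, ∃ P : F[X][X], B < polyHeight P ∧ P.natDegree ≤ n ∧ evalAt P ξ ≠ 0 ∧
      absVal (evalAt P ξ) < polyHeight P ^ (-w)) : (w : EReal) ≤ wExp ξ n := by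
  refine le_sSup ⟨w, infinite_of_forall_exists_polyHeight_gt fun B => ?_, rfl⟩
  obtain ⟨P, hB, hn, h0, hlt⟩ := h B
  exact ⟨P, ⟨hn, absVal_pos h0, hlt⟩, hB⟩

theorem absVal_polyEmb_X_pow (m : ℕ) : absVal (polyEmb F (X ^ m)) = (Nat.card F : ℝ) ^ m := by
  rw [absVal_polyEmb (pow_ne_zero _ X_ne_zero), natDegree_X_pow]

/-- The approximations are `(a + 1) / T ^ m`, with `a` the integral part of `T ^ m * ξ`. The shift
by 1 makes the distance exactly `q ^ (-m)`, hence nonzero even for rational `ξ`. -/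
theorem wStarExp_nonneg (ξ : LaurentSeries F) {n : ℕ} (hn : 1 ≤ n) : 0 ≤ wStarExp ξ n := by
  refine le_wStarExp (t := 0) (le_max_left 1 (absVal ξ)) (by norm_num) fun B => ?_
  obtain ⟨m, hm⟩ := pow_unbounded_of_one_lt B (one_lt_card (F := F))
  have hqm : (0 : ℝ) < (Nat.card F : ℝ) ^ m := pow_pos card_pos m
  have hT0 : polyEmb F (X ^ m) ≠ 0 :=
    (map_ne_zero_iff _ polyEmb_injective).2 (pow_ne_zero _ X_ne_zero)
  obtain ⟨a, ha⟩ := exists_polyEmb_near (polyEmb F (X ^ m) * ξ)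
  have hR1 : (C (X ^ m) * X - C (a + 1) : F[X][X]).coeff 1 = X ^ m := by
    rw [coeff_sub, coeff_C_mul, coeff_X_one, coeff_C_of_ne_zero one_ne_zero, mul_one, sub_zero]
  have hdist : absVal (polyEmb F (X ^ m) * ξ - polyEmb F (a + 1)) = 1 := by
    rw [map_add, map_one, ← sub_sub, absVal_sub_comm,
      absVal_sub_eq_left (by rwa [absVal_one]), absVal_one]
  have heq : ξ - polyEmb F (a + 1) / polyEmb F (X ^ m)
      = (polyEmb F (X ^ m) * ξ - polyEmb F (a + 1)) / polyEmb F (X ^ m) := by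
    field_simp
  refine ⟨C (X ^ m) * X - C (a + 1), polyEmb F (a + 1) / polyEmb F (X ^ m), _, hm, ?_, ?_, ?_, ?_,
    ?_, ?_⟩
  · intro h
    rw [h, coeff_zero] at hR1
    exact pow_ne_zero _ X_ne_zero hR1.symm
  · refine le_trans (natDegree_sub_le _ _) (max_le ?_ ?_)
    · exact ((natDegree_C_mul_le _ _).trans natDegree_X_le).trans hn
    · rw [natDegree_C]
      exact Nat.zero_le n
  · rw [sub_eq_add_neg, ← C_neg]
    refine (polyHeight_add_le _ _).trans (max_le ?_ ?_)
    · rw [polyHeight_mul, polyHeight_C, absVal_polyEmb_X_pow, mul_comm]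
      refine mul_le_mul_of_nonneg_right (le_trans ?_ (le_max_left _ _)) hqm.le
      rw [polyHeight_eq_gaussNorm, ← monomial_one_one_eq_X, gaussNorm_monomial]
      simp
    · rw [polyHeight_C, map_neg, absVal_neg]
      have : polyEmb F (a + 1) = polyEmb F (X ^ m) * ξ
          - (polyEmb F (X ^ m) * ξ - polyEmb F (a + 1)) := by ring
      rw [this]
      refine (absVal_sub_le _ _).trans (max_le ?_ ?_)
      · rw [absVal_mul, absVal_polyEmb_X_pow, mul_comm]
        exact mul_le_mul_of_nonneg_right (le_max_right _ _) hqm.le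
      · rw [hdist]
        exact one_le_mul_of_one_le_of_one_le (le_max_left _ _) (one_le_pow₀ one_lt_card.le)
  · rw [evalAt, eval₂_sub, eval₂_mul, eval₂_C, eval₂_C, eval₂_X]
    field_simp
    simp
  · intro h
    rw [← sub_eq_zero, heq] at h
    rcases div_eq_zero_iff.1 h with h | h
    · rw [h, absVal_zero] at hdist
      exact zero_ne_one hdist
    · exact hT0 h
  · rw [heq, absVal_div, hdist, absVal_polyEmb_X_pow, show (-0 - 1 : ℝ) = -1 by norm_num,
      Real.rpow_neg_one, one_div]
    exact le_mul_of_one_le_left (by positivity) (le_max_left _ _)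

theorem absVal_evalAt_le_of_root {P : F[X][X]} {n : ℕ} (hn : P.natDegree ≤ n)
    {ξ α : LaurentSeries F} (hα : evalAt P α = 0) (h : absVal (ξ - α) ≤ 1) :
    absVal (evalAt P ξ) ≤ polyHeight P * max 1 (absVal ξ) ^ n * absVal (ξ - α) := by
  have hg := absVal_taylor_coeff_le (f := P.map (polyEmb F)) (B := polyHeight P)
    (fun i => by rw [coeff_map]; exact absVal_coeff_le_polyHeight P i)
    (natDegree_map_le.trans hn) ξ
  have := absVal_eval_sub_eval_le hg (y := 0) (z := α - ξ) (by simp [absVal_zero])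
    (by rwa [absVal_sub_comm])
  rw [taylor_eval, taylor_eval, zero_add, sub_add_cancel, ← evalAt_eq_eval_map,
    ← evalAt_eq_eval_map, hα, sub_zero, zero_sub, neg_sub] at this
  exact this

theorem wStarExp_le_wExp (ξ : LaurentSeries F) {n : ℕ} (hn : 1 ≤ n) :
    wStarExp ξ n ≤ wExp ξ n := by
  refine le_of_forall_lt fun c hc => ?_
  have hlt : max c ((-1 : ℝ) : EReal) < wStarExp ξ n :=
    max_lt hc (lt_of_lt_of_le (by exact_mod_cast (by norm_num : (-1 : ℝ) < 0))
      (wStarExp_nonneg ξ hn))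
  obtain ⟨_, ⟨w, hw, rfl⟩, hcw⟩ := lt_sSup_iff.1 hlt
  obtain ⟨w', hcw', hww⟩ := EReal.lt_iff_exists_real_btwn.1 hcw
  rw [EReal.coe_lt_coe_iff] at hww
  have hw1 : -1 < w := EReal.coe_lt_coe_iff.1 ((le_max_right _ _).trans_lt hcw)
  refine ((le_max_left _ _).trans_lt hcw').trans_le (le_wExp fun B => ?_)
  obtain ⟨B', hB'1, hB'⟩ := exists_forall_lt_rpow (max 1 (absVal ξ) ^ n) (sub_pos.2 hww)
  have hfin1 : {α : LaurentSeries F | ∃ P : F[X][X], IsMinDefPoly P α ∧ P.natDegree ≤ n ∧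
      polyHeight P ≤ max B B'}.Finite := by
    refine ((finite_setOf_polyHeight_le n (max B B')).inter_of_left {P | P ≠ 0}).biUnion
      (fun P hP => finite_setOf_evalAt_eq_zero hP.2) |>.subset ?_
    rintro α ⟨P, hP, hPn, hPB⟩
    exact Set.mem_biUnion (x := P) ⟨⟨hPn, hPB⟩, hP.1.ne_zero⟩ hP.2
  -- Conjugates of `ξ` must be discarded, since their minimal polynomial vanishes at `ξ`; they are
  -- finite in number, and there are none for transcendental `ξ`.
  have hfin2 : {α : LaurentSeries F | ∃ P : F[X][X], IsMinDefPoly P α ∧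
      evalAt P ξ = 0}.Finite := by
    by_cases hM : ∃ M : F[X][X], IsMinDefPoly M ξ
    · obtain ⟨M, hM⟩ := hM
      refine (finite_setOf_evalAt_eq_zero hM.1.ne_zero).subset ?_
      rintro α ⟨P, hP, hPξ⟩
      obtain ⟨S, hS⟩ := (IsMinDefPoly.associated ⟨hP.1, hPξ⟩ hM).dvd
      change evalAt M α = 0
      rw [hS, evalAt_mul, hP.2, zero_mul]
    · refine Set.finite_empty.subset ?_
      rintro α ⟨P, hP, hPξ⟩
      exact hM ⟨P, hP.1, hPξ⟩
  obtain ⟨α, ⟨P, hP, hPn, -, hlt'⟩, hα⟩ := (hw.out.sdiff (hfin1.union hfin2)).nonempty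
  have hPB : max B B' < polyHeight P := by
    by_contra h
    exact hα (Or.inl ⟨P, hP, hPn, not_lt.1 h⟩)
  have hPξ : evalAt P ξ ≠ 0 := fun h => hα (Or.inr ⟨P, hP, h⟩)
  have hH := hB' _ ((le_max_right _ _).trans_lt hPB)
  have hpos := polyHeight_pos hP.1.ne_zero
  refine ⟨P, (le_max_left _ _).trans_lt hPB, hPn, hPξ, ?_⟩
  have hle1 : absVal (ξ - α) ≤ 1 := hlt'.le.trans
    (Real.rpow_le_one_of_one_le_of_nonpos (one_le_polyHeight hP.1.ne_zero) (by linarith))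
  have hE : 0 < max 1 (absVal ξ) ^ n := by positivity
  calc absVal (evalAt P ξ)
      ≤ polyHeight P * max 1 (absVal ξ) ^ n * absVal (ξ - α) :=
        absVal_evalAt_le_of_root hPn hP.2 hle1
    _ ≤ polyHeight P * max 1 (absVal ξ) ^ n * polyHeight P ^ (-w - 1) := by gcongr
    _ < polyHeight P * polyHeight P ^ (w - w') * polyHeight P ^ (-w - 1) := by
        have := Real.rpow_pos_of_pos hpos (-w - 1)
        gcongr
    _ = polyHeight P ^ (-w') := by
        nth_rw 1 [← Real.rpow_one (polyHeight P)]
        rw [← Real.rpow_add hpos, ← Real.rpow_add hpos]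
        ring_nf

/-- The derivative of a separable irreducible polynomial is not too small where the polynomial
itself is very small. -/
theorem one_le_absVal_derivative {P : F[X][X]} (hi : Irreducible P) (hd : derivative P ≠ 0)
    {n : ℕ} (hn : P.natDegree ≤ n) {ξ : LaurentSeries F}
    (hsmall : max 1 (absVal ξ) ^ n * polyHeight P ^ (3 * n) * absVal (evalAt P ξ) < 1) :
    1 ≤ max 1 (absVal ξ) ^ n * polyHeight P ^ (3 * n) * absVal (evalAt (derivative P) ξ) := by
  obtain ⟨h, hh⟩ := exists_polyHeight_eq_pow hi.ne_zero
  have hdeg : 0 < P.natDegree := by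
    by_contra h0
    exact hd (derivative_of_natDegree_zero (by lia))
  have hlt := natDegree_derivative_lt hdeg.ne'
  have hndvd : ¬ P ∣ derivative P := fun hdvd =>
    hlt.not_ge (natDegree_le_of_dvd hdvd hd)
  -- At `ξ` the identity `A * P' + B * P = c` has right side at least 1 in absolute value, while
  -- `hsmall` makes the term with `P` less than 1. With both heights at most `H(P)` and degrees at
  -- most `n`, the cofactors have height at most `H(P) ^ (3n)`.
  obtain ⟨A, B, c, hABc, hc, hAn, hBn, hA, hB⟩ := exists_mul_add_mul_eq_C hi hndvd hdeg
    (hlt.le.trans hn) hh.le (hh ▸ polyHeight_derivative_le P)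
  have hA' : polyHeight A ≤ polyHeight P ^ (3 * n) := by
    rw [hh, ← pow_mul]
    refine hA.trans (pow_le_pow_right₀ one_lt_card.le ?_)
    rw [← add_mul, mul_comm h]
    exact Nat.mul_le_mul_right h (by lia)
  have hB' : polyHeight B ≤ polyHeight P ^ (3 * n) := by
    rw [hh, ← pow_mul]
    refine hB.trans (pow_le_pow_right₀ one_lt_card.le ?_)
    rw [← add_mul, mul_comm h]
    exact Nat.mul_le_mul_right h (by lia)
  have hE : 0 < max 1 (absVal ξ) ^ n := by positivity
  have hval : ∀ S : F[X][X], S.natDegree ≤ n → polyHeight S ≤ polyHeight P ^ (3 * n) →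
      absVal (evalAt S ξ) ≤ max 1 (absVal ξ) ^ n * polyHeight P ^ (3 * n) := fun S hSn hS =>
    (absVal_evalAt_le hSn ξ).trans (by rw [mul_comm]; gcongr)
  have h1 : 1 ≤ max (absVal (evalAt A ξ) * absVal (evalAt (derivative P) ξ))
      (absVal (evalAt B ξ) * absVal (evalAt P ξ)) := by
    rw [← absVal_mul, ← absVal_mul, ← evalAt_mul, ← evalAt_mul]
    refine le_trans ?_ (absVal_add_le _ _)
    rw [← evalAt_add, hABc, evalAt_C]
    exact one_le_absVal_polyEmb hc
  rcases le_max_iff.1 h1 with h1 | h1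
  · exact h1.trans (mul_le_mul_of_nonneg_right (hval A (hAn.trans hn) hA') (absVal_nonneg _))
  · exact absurd (h1.trans (mul_le_mul_of_nonneg_right (hval B hBn hB')
      (absVal_nonneg _))) hsmall.not_ge

/-- With `|P'(ξ)| ≥ (E * H ^ (3n))⁻¹`, Newton's condition follows from `|P(ξ)| < H ^ (-6n - 2)` and
`E ^ 3 < H`; the former holds because `w' ≥ 8n ≥ 6n + 2`. The root is within `E * H ^ (3n - w')` of
`ξ`. -/
theorem le_wStarExp_of_infinite {ξ : LaurentSeries F} {n : ℕ} (hn : 1 ≤ n) {w w' : ℝ}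
    (hw' : 8 * n ≤ w') (hww : w' < w)
    (hinf : {P : F[X][X] | P.natDegree ≤ n ∧ 0 < absVal (evalAt P ξ) ∧
      absVal (evalAt P ξ) < polyHeight P ^ (-w)}.Infinite) :
    ((w' - 3 * n - 1 : ℝ) : EReal) ≤ wStarExp ξ n := by
  have hn1 : (1 : ℝ) ≤ n := by exact_mod_cast hn
  set E := max 1 (absVal ξ) ^ n with hEdef
  have hE1 : 1 ≤ E := one_le_pow₀ (le_max_left _ _)
  refine le_wStarExp hE1 (by linarith) fun B => ?_
  obtain ⟨P, hi, hd, hPn, hPB, hP0, hlt⟩ := exists_separable_irreducible (by linarith) hww hinf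
    (max B (E ^ 3))
  have hpos := polyHeight_pos hi.ne_zero
  have hH1 := one_le_polyHeight hi.ne_zero
  have hHE : E ^ 3 < polyHeight P := (le_max_right _ _).trans_lt hPB
  set H := polyHeight P with hH
  have hlt1 : absVal (evalAt P ξ) < H ^ (-(3 * n : ℕ) - 1 : ℝ) := hlt.trans_le
    (Real.rpow_le_rpow_of_exponent_le hH1 (by push_cast; linarith))
  have hlt2 : absVal (evalAt P ξ) < H ^ (-(6 * n : ℕ) - 2 : ℝ) := hlt.trans_le
    (Real.rpow_le_rpow_of_exponent_le hH1 (by push_cast; linarith))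
  have e1 : H ^ (-(3 * n : ℕ) - 1 : ℝ) * (H ^ (3 * n) * H) = 1 := by
    rw [← Real.rpow_natCast H (3 * n), ← Real.rpow_add_one hpos.ne', ← Real.rpow_add hpos]
    ring_nf
    simp
  have e2 : H ^ (-(6 * n : ℕ) - 2 : ℝ) * ((H ^ (3 * n)) ^ 2 * H ^ 2) = 1 := by
    rw [← pow_mul, ← pow_add, ← Real.rpow_natCast H, ← Real.rpow_add hpos]
    push_cast
    ring_nf
    simp
  have hHn : 0 < H ^ (3 * n) := by positivity
  have hEE : E ≤ E ^ 3 := le_self_pow₀ hE1 (by norm_num)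
  have hder := one_le_absVal_derivative hi hd hPn (ξ := ξ) (by
    rw [← hEdef, ← hH]
    calc E * H ^ (3 * n) * absVal (evalAt P ξ)
        < H * H ^ (3 * n) * H ^ (-(3 * n : ℕ) - 1 : ℝ) := by
          have : E < H := hEE.trans_lt hHE
          gcongr
      _ = 1 := by linear_combination e1)
  rw [← hEdef, ← hH] at hder
  have hD : 0 < absVal (evalAt (derivative P) ξ) := by
    by_contra h0
    have := le_antisymm (not_lt.1 h0) (absVal_nonneg _)
    rw [this, mul_zero] at hder
    linarith
  have hmap : (P.map (polyEmb F)).derivative.eval ξ = evalAt (derivative P) ξ := by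
    rw [derivative_map, ← evalAt_eq_eval_map]
  obtain ⟨α, hα, hdist⟩ := exists_root_near (f := P.map (polyEmb F)) (B := H) (n := n) (x := ξ)
    (fun i => by rw [coeff_map]; exact absVal_coeff_le_polyHeight P i)
    (natDegree_map_le.trans hPn) (by
      rw [← evalAt_eq_eval_map, hmap, ← hEdef]
      set D := absVal (evalAt (derivative P) ξ)
      have h1 : absVal (evalAt P ξ) * (H * E) * (E * H ^ (3 * n)) ^ 2 < 1 := by
        calc absVal (evalAt P ξ) * (H * E) * (E * H ^ (3 * n)) ^ 2
            = absVal (evalAt P ξ) * (E ^ 3 * H * (H ^ (3 * n)) ^ 2) := by ring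
          _ < H ^ (-(6 * n : ℕ) - 2 : ℝ) * (H * H * (H ^ (3 * n)) ^ 2) := by gcongr
          _ = 1 := by linear_combination e2
      have h2 : 1 ≤ (E * H ^ (3 * n) * D) ^ 2 := one_le_pow₀ hder
      rw [mul_pow, mul_comm] at h2
      exact lt_of_mul_lt_mul_right (h1.trans_le h2) (by positivity))
  rw [← evalAt_eq_eval_map] at hα
  rw [← evalAt_eq_eval_map, hmap] at hdist
  refine ⟨P, α, H, (le_max_left _ _).trans_lt hPB, hi.ne_zero, hPn,
    le_mul_of_one_le_left hpos.le hE1, hα, ?_, hdist.trans ?_⟩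
  · rintro rfl
    rw [hα, absVal_zero] at hP0
    exact hP0.false
  · rw [div_le_iff₀ hD]
    have e3 : H ^ (-(w' - 3 * n - 1) - 1) = H ^ (-w') * H ^ (3 * n) := by
      rw [← Real.rpow_natCast H (3 * n), ← Real.rpow_add hpos]
      push_cast
      ring_nf
    rw [e3]
    calc absVal (evalAt P ξ) ≤ H ^ (-w') := hlt.le
      _ ≤ H ^ (-w') * (E * H ^ (3 * n) * absVal (evalAt (derivative P) ξ)) :=
          le_mul_of_one_le_right (Real.rpow_nonneg hpos.le _) hder
      _ = _ := by ring

theorem wExp_le_wStarExp_add (ξ : LaurentSeries F) {n : ℕ} (hn : 1 ≤ n) :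
    wExp ξ n ≤ wStarExp ξ n + ((8 * n : ℝ) : EReal) := by
  have hn1 : (1 : ℝ) ≤ n := by exact_mod_cast hn
  have h0 := wStarExp_nonneg ξ hn
  refine le_of_forall_lt fun c hc => ?_
  obtain ⟨_, ⟨w, hw, rfl⟩, hcw⟩ := lt_sSup_iff.1 hc
  obtain ⟨w', hcw', hww⟩ := EReal.lt_iff_exists_real_btwn.1 hcw
  rw [EReal.coe_lt_coe_iff] at hww
  refine hcw'.trans_le ?_
  by_cases h8 : w' ≤ 8 * n
  · calc ((w' : ℝ) : EReal) ≤ 0 + ((8 * n : ℝ) : EReal) := by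
          rw [zero_add]
          exact EReal.coe_le_coe_iff.2 h8
      _ ≤ _ := by gcongr
  · have := le_wStarExp_of_infinite hn (not_le.1 h8).le hww hw
    calc ((w' : ℝ) : EReal) ≤ ((w' - 3 * n - 1 : ℝ) : EReal) + ((8 * n : ℝ) : EReal) := by
          rw [← EReal.coe_add, EReal.coe_le_coe_iff]
          linarith
      _ ≤ _ := by gcongr

end Finite

section Finite

variable [Finite F]

/-! ### Algebraic elements -/

/-- Liouville's inequality. -/
theorem wExp_le_of_isMinDefPoly {ξ : LaurentSeries F} {M : F[X][X]} (hM : IsMinDefPoly M ξ)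
    (n : ℕ) : wExp ξ n ≤ ((M.natDegree : ℝ) : EReal) := by
  refine sSup_le ?_
  rintro _ ⟨w, hw, rfl⟩
  rw [EReal.coe_le_coe_iff]
  by_contra! hlt
  obtain ⟨m, hm⟩ := exists_polyHeight_eq_pow hM.1.ne_zero
  set d := M.natDegree with hd
  have hd0 : 0 < d := Nat.pos_of_ne_zero hM.natDegree_ne_zero
  set K : ℝ := (Nat.card F : ℝ) ^ ((d + n) * m) * max 1 (absVal ξ) ^ d with hK
  have hqpos := card_pos (F := F)
  have hKpos : 0 < K := by positivity
  obtain ⟨B, hB1, hB⟩ := exists_forall_lt_rpow K (sub_pos.2 hlt)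
  obtain ⟨P, ⟨hPn, hP0, hP⟩, hPB⟩ := exists_polyHeight_gt_of_infinite hw.out (fun P hP => hP.1) B
  rw [absVal_pos_iff] at hP0
  obtain ⟨h, hh⟩ := exists_polyHeight_eq_pow (ne_zero_of_evalAt_ne_zero hP0)
  have hndvd : ¬ M ∣ P := by
    rintro ⟨S, rfl⟩
    exact hP0 (by rw [evalAt_mul, hM.2, zero_mul])
  -- At `ξ` the term with `M` disappears, so `1 ≤ |A(ξ)| * |P(ξ)|`, where `H(A)` is at most a
  -- constant times `H(P) ^ (d - 1)`; the weaker exponent `d` suffices.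
  obtain ⟨A, B', c, hABc, hc, hAn, -, hA, -⟩ :=
    exists_mul_add_mul_eq_C hM.1 hndvd hd0 hPn hm.le hh.le
  have hpos : 0 < polyHeight P := by linarith
  have h1 : 1 ≤ absVal (evalAt A ξ) * absVal (evalAt P ξ) := by
    have := congrArg (fun S => evalAt S ξ) hABc
    simp only [evalAt_add, evalAt_mul, hM.2, mul_zero, add_zero, evalAt_C] at this
    rw [← absVal_mul, this]
    exact one_le_absVal_polyEmb hc
  have h2 : absVal (evalAt A ξ) ≤ polyHeight P ^ (d : ℝ) * K := by
    refine (absVal_evalAt_le hAn ξ).trans ?_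
    rw [hK, ← mul_assoc, Real.rpow_natCast, hh, ← pow_mul, ← pow_add]
    gcongr
    refine hA.trans (pow_le_pow_right₀ one_lt_card.le ?_)
    have : (d - 1) * h ≤ h * d := by rw [mul_comm h]; exact Nat.mul_le_mul_right h (by lia)
    lia
  have h3 := hB _ hPB
  have h4 : 1 < polyHeight P ^ (d : ℝ) * polyHeight P ^ (w - d) * polyHeight P ^ (-w) := by
    have := Real.rpow_pos_of_pos hpos (d : ℝ)
    have := absVal_nonneg (evalAt P ξ)
    calc 1 ≤ absVal (evalAt A ξ) * absVal (evalAt P ξ) := h1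
      _ ≤ polyHeight P ^ (d : ℝ) * K * absVal (evalAt P ξ) :=
          mul_le_mul_of_nonneg_right h2 (absVal_nonneg _)
      _ < _ := by gcongr
  rw [← Real.rpow_add hpos, ← Real.rpow_add hpos] at h4
  ring_nf at h4
  simp at h4

/-! ### Transcendental elements -/

/-- Every polynomial over `F((T⁻¹))` has an integral part. -/
theorem exists_polynomial_near (U : (LaurentSeries F)[X]) :
    ∃ V : F[X][X], V.natDegree ≤ U.natDegree ∧
      ∀ i, absVal ((U - V.map (polyEmb F)).coeff i) ≤ 1 := by
  choose a ha using fun x : LaurentSeries F => exists_polyEmb_near x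
  refine ⟨∑ i ∈ Finset.range (U.natDegree + 1), monomial i (a (U.coeff i)), ?_, fun i => ?_⟩
  · refine natDegree_sum_le_of_forall_le _ _ fun i hi => (natDegree_monomial_le _).trans ?_
    rw [Finset.mem_range] at hi
    lia
  · rw [coeff_sub, coeff_map]
    simp only [finsetSum_coeff, coeff_monomial, Finset.sum_ite_eq', Finset.mem_range]
    split_ifs with h
    · exact (ha _).le
    · rw [coeff_eq_zero_of_natDegree_lt (by lia), map_zero, sub_zero, absVal_zero]
      exact zero_le_one

theorem absVal_coeff_mul_le {f g : (LaurentSeries F)[X]} {A B : ℝ}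
    (hf : ∀ i, absVal (f.coeff i) ≤ A) (hg : ∀ i, absVal (g.coeff i) ≤ B) (i : ℕ) :
    absVal ((f * g).coeff i) ≤ A * B := by
  have hA : 0 ≤ A := (absVal_nonneg _).trans (hf 0)
  have hB : 0 ≤ B := (absVal_nonneg _).trans (hg 0)
  rw [coeff_mul]
  refine absVal_sum_le _ _ (mul_nonneg hA hB) fun x _ => ?_
  rw [absVal_mul]
  exact mul_le_mul (hf _) (hg _) (absVal_nonneg _) hA

/-- Modulo an irreducible `P` and a polynomial `Q` prime to it, every polynomial over `F((T⁻¹))` is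
congruent to an integral one, up to an error controlled by `P` and `Q`. -/
theorem exists_integral_combination {P Q : F[X][X]} (hP : Irreducible P) (hd : 0 < P.natDegree)
    (hPQ : ¬ P ∣ Q) {n : ℕ} (hPn : P.natDegree ≤ n) (hQn : Q.natDegree ≤ n)
    (v : (LaurentSeries F)[X]) (hv : v.natDegree ≤ 2 * n) :
    ∃ (R : F[X][X]) (e₁ e₂ : (LaurentSeries F)[X]), R.natDegree ≤ 2 * n ∧
      v - R.map (polyEmb F) = e₁ * P.map (polyEmb F) + e₂ * Q.map (polyEmb F) ∧
      e₁.natDegree + P.natDegree ≤ 2 * n ∧ e₂.natDegree ≤ n ∧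
      (∀ i, absVal (e₁.coeff i) ≤ 1) ∧ ∀ i, absVal (e₂.coeff i) ≤ 1 := by
  obtain ⟨m, hm⟩ := exists_polyHeight_eq_pow hP.ne_zero
  have hQ0 : Q ≠ 0 := fun h => hPQ (h ▸ dvd_zero P)
  obtain ⟨h, hh⟩ := exists_polyHeight_eq_pow hQ0
  obtain ⟨A, B, c, hABc, hc, -⟩ := exists_mul_add_mul_eq_C hP hPQ hd hQn hm.le hh.le
  set φ := Polynomial.mapRingHom (polyEmb F) with hφ
  have hmap : ∀ S : F[X][X], S.map (polyEmb F) = φ S := fun S => rfl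
  have hc' : polyEmb F c ≠ 0 := (map_ne_zero_iff _ polyEmb_injective).2 hc
  have hbez : φ A * φ Q + φ B * φ P = C (polyEmb F c) := by
    rw [← map_mul, ← map_mul, ← map_add, hABc, hφ, coe_mapRingHom, map_C]
  have hdeg : ∀ S : F[X][X], (φ S).natDegree = S.natDegree := fun S =>
    natDegree_map_eq_of_injective polyEmb_injective S
  have hP0 : φ P ≠ 0 := (Polynomial.map_ne_zero_iff polyEmb_injective).2 hP.ne_zero
  set V₀ := v * C (polyEmb F c)⁻¹ * φ A
  set U₀ := v * C (polyEmb F c)⁻¹ * φ B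
  have hUV₀ : U₀ * φ P + V₀ * φ Q = v := by
    have : (C (polyEmb F c)⁻¹ : (LaurentSeries F)[X]) * C (polyEmb F c) = 1 := by
      rw [← C_mul, inv_mul_cancel₀ hc', C_1]
    simp only [U₀, V₀]
    linear_combination v * C (polyEmb F c)⁻¹ * hbez + v * this
  -- Reducing `V` modulo `P` controls the degrees: `V` has degree at most `n`, and then `U * P = v -
  -- V * Q` has degree at most `2n`.
  set V := V₀ % φ P with hVdef
  set U := U₀ + V₀ / φ P * φ Q with hUdef
  have hUV : U * φ P + V * φ Q = v := by
    have := EuclideanDomain.div_add_mod V₀ (φ P)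
    simp only [hUdef, hVdef]
    linear_combination hUV₀ + φ Q * this
  have hVn : V.natDegree ≤ n := by
    refine le_trans (natDegree_le_natDegree ?_) ((hdeg P).trans_le hPn)
    exact (EuclideanDomain.mod_lt V₀ hP0).le
  have hUn : U.natDegree + P.natDegree ≤ 2 * n := by
    by_cases hU0 : U = 0
    · rw [hU0, natDegree_zero]
      lia
    rw [← hdeg P, ← natDegree_mul hU0 hP0, eq_sub_of_add_eq hUV]
    refine (natDegree_sub_le _ _).trans (max_le hv (natDegree_mul_le.trans ?_))
    rw [hdeg]
    lia
  obtain ⟨U', hU'n, hU'⟩ := exists_polynomial_near U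
  obtain ⟨V', hV'n, hV'⟩ := exists_polynomial_near V
  refine ⟨U' * P + V' * Q, U - φ U', V - φ V', ?_, ?_, ?_, ?_, hU', hV'⟩
  · refine (natDegree_add_le _ _).trans (max_le (natDegree_mul_le.trans ?_)
      (natDegree_mul_le.trans ?_)) <;> lia
  · simp only [hmap, map_add, map_mul]
    linear_combination -hUV
  · have := natDegree_sub_le U (φ U')
    rw [hdeg] at this
    have := max_le (le_refl U.natDegree) hU'n
    lia
  · refine (natDegree_sub_le _ _).trans (max_le hVn ?_)
    rw [hdeg]
    lia

/-- Dirichlet's polynomials have values tending to 0 that never vanish, so infinitely many of them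
occur. -/
theorem infinite_of_transcendental {ξ : LaurentSeries F}
    (hξ : ∀ P : F[X][X], P ≠ 0 → evalAt P ξ ≠ 0) {n : ℕ} (hn : 1 ≤ n) {w : ℝ} (hw0 : 0 ≤ w)
    (hw : w < n) : {P : F[X][X] | P.natDegree ≤ n ∧ 0 < absVal (evalAt P ξ) ∧
      absVal (evalAt P ξ) < polyHeight P ^ (-w)}.Infinite := by
  obtain ⟨K, hK, hdir⟩ := exists_small_value ξ n
  refine infinite_of_forall_exists_absVal_lt (fun P => evalAt P ξ) fun ε hε => ?_
  obtain ⟨B₁, hB₁1, hB₁⟩ := exists_forall_lt_rpow K (sub_pos.2 hw)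
  obtain ⟨B₂, -, hB₂⟩ := exists_forall_lt_rpow (K / ε) (by exact_mod_cast hn : (0 : ℝ) < n)
  obtain ⟨h, hh⟩ := pow_unbounded_of_one_lt (max B₁ B₂) (one_lt_card (F := F))
  obtain ⟨P, hP0, hPn, hPh, hP⟩ := hdir h
  set H : ℝ := (Nat.card F : ℝ) ^ h
  have h1 := hB₁ H ((le_max_left _ _).trans_lt hh)
  have h2 := hB₂ H ((le_max_right _ _).trans_lt hh)
  have hHpos : 0 < H := by linarith [(le_max_left _ _).trans_lt hh]
  have hz : H ^ (-(n : ℤ)) = H ^ (-(n : ℝ)) := by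
    rw [← Real.rpow_intCast]
    push_cast
    rfl
  rw [hz] at hP
  refine ⟨P, ⟨hPn, absVal_pos (hξ P hP0), ?_⟩, hξ P hP0, ?_⟩
  · refine lt_of_lt_of_le ?_ (Real.rpow_le_rpow_of_nonpos (polyHeight_pos hP0) hPh
      (by linarith))
    refine hP.trans_lt ?_
    have : H ^ (-w) = H ^ ((n : ℝ) - w) * H ^ (-(n : ℝ)) := by
      rw [← Real.rpow_add hHpos]
      ring_nf
    rw [this]
    have := Real.rpow_pos_of_pos hHpos (-(n : ℝ))
    gcongr
  · refine hP.trans_lt ?_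
    rw [Real.rpow_neg hHpos.le, ← div_eq_mul_inv, div_lt_iff₀ (Real.rpow_pos_of_pos hHpos _)]
    rwa [div_lt_iff₀ hε, mul_comm] at h2

/-- Transcendental elements are well approximated by algebraic ones. -/
theorem half_le_wStarExp {ξ : LaurentSeries F} (hξ : ∀ P : F[X][X], P ≠ 0 → evalAt P ξ ≠ 0)
    {n : ℕ} (hn : 1 ≤ n) : ((n / 2 : ℝ) : EReal) ≤ wStarExp ξ (2 * n) := by
  have hn1 : (1 : ℝ) ≤ n := by exact_mod_cast hn
  have hq1 := one_lt_card (F := F)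
  have hq0 := card_pos (F := F)
  obtain ⟨K, hK, hdir⟩ := exists_small_value ξ n
  set E := max 1 (absVal ξ) ^ (2 * n) with hEdef
  have hE1 : 1 ≤ E := one_le_pow₀ (le_max_left _ _)
  have hE2 : absVal ξ ≤ E := (le_max_right 1 _).trans
    (le_self_pow₀ (le_max_left 1 (absVal ξ)) (by lia))
  obtain ⟨e, he⟩ := pow_unbounded_of_one_lt E (one_lt_card (F := F))
  set q : ℝ := ((Nat.card F : ℕ) : ℝ) with hq
  set K₁ := max 1 (K * q ^ n) with hK₁
  have hK₁1 : 1 ≤ K₁ := le_max_left _ _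
  set K₂ := q ^ e * E * K₁ * E with hK₂
  have hqe : 1 ≤ q ^ e := one_le_pow₀ hq1.le
  have hK₂1 : 1 ≤ K₂ := by
    have h1 := one_le_mul_of_one_le_of_one_le hqe hE1
    have h2 := one_le_mul_of_one_le_of_one_le h1 hK₁1
    exact one_le_mul_of_one_le_of_one_le h2 hE1
  refine le_wStarExp hK₂1 (by linarith) fun B => ?_
  obtain ⟨B₁, hB₁1, hB₁⟩ := exists_forall_lt_rpow (E * K₁ * E * E) (s := 1) one_pos
  -- Passing to separable irreducible polynomials needs a strict loss; `n / 2 < 3n / 4 < n` leaves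
  -- room below Dirichlet's exponent.
  obtain ⟨P, hPi, hPd, hPn, hPB, hP0, hPlt⟩ := exists_separable_irreducible (ξ := ξ)
    (w := 3 * n / 4) (w' := n / 2) (by linarith) (by linarith)
    (infinite_of_transcendental hξ hn (by linarith) (by linarith)) (max B B₁)
  obtain ⟨h, hh⟩ := exists_polyHeight_eq_pow hPi.ne_zero
  rw [← hq] at hh
  set H := polyHeight P with hH
  have hHB : B₁ < H := (le_max_right _ _).trans_lt hPB
  have hH1 : 1 < H := hB₁1.trans_lt hHB
  have hHpos : 0 < H := by linarith
  obtain ⟨k, rfl⟩ : ∃ k, h = k + 1 := by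
    rcases h with _ | k
    · rw [pow_zero] at hh
      linarith
    · exact ⟨k, rfl⟩
  -- Dirichlet at height `q ^ k = H / q`: as `Q` has smaller height than `P`, it cannot be a
  -- multiple of `P`.
  obtain ⟨Q, hQ0, hQn, hQh, hQ⟩ := hdir k
  have hdeg : 0 < P.natDegree := by
    by_contra h0
    exact hPd (derivative_of_natDegree_zero (by lia))
  have hndvd : ¬ P ∣ Q := fun hdvd => by
    have h1 := polyHeight_le_of_dvd hdvd hQ0
    rw [← hH, hh] at h1
    exact (pow_lt_pow_right₀ hq1 (Nat.lt_succ_self k)).not_ge (h1.trans hQh)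
  have hQH : polyHeight Q ≤ H :=
    hQh.trans (hh ▸ pow_le_pow_right₀ hq1.le (Nat.le_succ k))
  have hQlt : absVal (evalAt Q ξ) ≤ K₁ * H ^ (-(n / 2) : ℝ) := by
    have : (q ^ k) ^ (-(n : ℤ)) = q ^ n * H ^ (-(n : ℝ)) := by
      rw [hh, Real.rpow_neg (by positivity), Real.rpow_natCast, zpow_neg, zpow_natCast, pow_succ,
        mul_pow, mul_inv]
      field_simp
    rw [this, ← mul_assoc] at hQ
    refine hQ.trans (mul_le_mul (le_max_right _ _)
      (Real.rpow_le_rpow_of_exponent_le hH1.le (by linarith)) (Real.rpow_nonneg hHpos.le _)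
      (by positivity))
  have hPlt' : absVal (evalAt P ξ) ≤ K₁ * H ^ (-(n / 2) : ℝ) :=
    hPlt.le.trans (le_mul_of_one_le_left (Real.rpow_nonneg hHpos.le _) hK₁1)
  -- The extra exponent `e`, with `q ^ e > E`, makes `|T| = H * q ^ e` exceed the bound `H * E` for
  -- the derivative of the error `W` at `ξ`. So `R'(ξ)` has the absolute value of `v'(ξ) = T`, while
  -- `v(ξ) = 0`.
  set T := polyEmb F (X ^ (k + 1 + e)) with hT
  have hTabs : absVal T = H * q ^ e := by rw [hT, absVal_polyEmb_X_pow, pow_add, ← hh]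
  set v : (LaurentSeries F)[X] := C T * (X - C ξ) with hv
  have hvn : v.natDegree ≤ 2 * n := by
    refine (natDegree_C_mul_le _ _).trans ?_
    rw [natDegree_X_sub_C]
    lia
  obtain ⟨R, e₁, e₂, hRn, hR, he₁n, he₂n, he₁, he₂⟩ :=
    exists_integral_combination hPi hdeg hndvd hPn hQn v hvn
  set W := e₁ * P.map (polyEmb F) + e₂ * Q.map (polyEmb F) with hW
  have hRW : R.map (polyEmb F) = v - W := by rw [← hR]; ring
  have hWc : ∀ i, absVal (W.coeff i) ≤ H := by
    intro i
    rw [hW, coeff_add]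
    refine (absVal_add_le _ _).trans (max_le ?_ ?_)
    · have := absVal_coeff_mul_le he₁ (g := P.map (polyEmb F)) (B := H)
        (fun i => by rw [coeff_map]; exact absVal_coeff_le_polyHeight P i) i
      rwa [one_mul] at this
    · have := absVal_coeff_mul_le he₂ (g := Q.map (polyEmb F)) (B := H)
        (fun i => by rw [coeff_map]; exact (absVal_coeff_le_polyHeight Q i).trans hQH) i
      rwa [one_mul] at this
  have hWn : W.natDegree ≤ 2 * n := by
    refine (natDegree_add_le _ _).trans (max_le (natDegree_mul_le.trans ?_)
      (natDegree_mul_le.trans ?_))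
    · have := natDegree_map_le (p := P) (f := polyEmb F)
      lia
    · have := natDegree_map_le (p := Q) (f := polyEmb F)
      lia
  have hWξ : absVal (W.eval ξ) ≤ E * (K₁ * H ^ (-(n / 2) : ℝ)) := by
    rw [hW, eval_add, eval_mul, eval_mul, ← evalAt_eq_eval_map, ← evalAt_eq_eval_map]
    refine (absVal_add_le _ _).trans (max_le ?_ ?_)
    · rw [absVal_mul]
      refine mul_le_mul ?_ hPlt' (absVal_nonneg _) (by positivity)
      simpa using absVal_eval_le he₁ (n := 2 * n) (by lia) ξ
    · rw [absVal_mul]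
      refine mul_le_mul ?_ hQlt (absVal_nonneg _) (by positivity)
      simpa using absVal_eval_le he₂ (n := 2 * n) (by lia) ξ
  have hW'ξ : absVal (W.derivative.eval ξ) ≤ H * E := by
    have := absVal_taylor_coeff_le hWc hWn ξ 1
    rwa [taylor_coeff_one] at this
  have hRξ : absVal ((R.map (polyEmb F)).eval ξ) ≤ E * (K₁ * H ^ (-(n / 2) : ℝ)) := by
    rw [hRW, eval_sub, hv]
    simpa [absVal_neg] using hWξ
  have hR'ξ : absVal ((R.map (polyEmb F)).derivative.eval ξ) = H * q ^ e := by
    have hv' : v.derivative.eval ξ = T := by simp [hv]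
    rw [hRW, derivative_sub, eval_sub, hv', absVal_sub_eq_left, hTabs]
    rw [hTabs]
    exact hW'ξ.trans_lt (by gcongr)
  have hRH : polyHeight R ≤ q ^ e * E * H := by
    have hnn : 0 ≤ q ^ e * E * H := by positivity
    rw [polyHeight_le_iff hnn]
    intro i
    rw [← coeff_map, hRW, coeff_sub]
    refine (absVal_sub_le _ _).trans (max_le ?_ ((hWc i).trans ?_))
    · rw [hv, coeff_C_mul, absVal_mul, hTabs]
      have : absVal ((X - C ξ : (LaurentSeries F)[X]).coeff i) ≤ E := by
        rw [coeff_sub, coeff_X, coeff_C]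
        refine (absVal_sub_le _ _).trans (max_le ?_ ?_)
        · split_ifs
          · rwa [absVal_one]
          · rw [absVal_zero]
            positivity
        · split_ifs
          · exact hE2
          · rw [absVal_zero]
            positivity
      calc H * q ^ e * absVal ((X - C ξ : (LaurentSeries F)[X]).coeff i)
          ≤ H * q ^ e * E := by gcongr
        _ = _ := by ring
    · exact le_mul_of_one_le_left hHpos.le (one_le_mul_of_one_le_of_one_le hqe hE1)
  have hR0 : R ≠ 0 := by
    rintro rfl
    rw [Polynomial.map_zero, derivative_zero, eval_zero, absVal_zero] at hR'ξ
    exact absurd hR'ξ (by positivity)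
  have hrp1 : H ^ (-(n / 2) : ℝ) ≤ 1 :=
    Real.rpow_le_one_of_one_le_of_nonpos hH1.le (by linarith)
  have hrp0 : 0 < H ^ (-(n / 2) : ℝ) := Real.rpow_pos_of_pos hHpos _
  obtain ⟨α, hα, hdist⟩ := exists_root_near (f := R.map (polyEmb F)) (B := q ^ e * E * H)
    (n := 2 * n) (x := ξ)
    (fun i => by rw [coeff_map]; exact (absVal_coeff_le_polyHeight R i).trans hRH)
    (natDegree_map_le.trans hRn) (by
      rw [hR'ξ, ← hEdef]
      have hbig := hB₁ H hHB
      rw [Real.rpow_one] at hbig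
      calc absVal ((R.map (polyEmb F)).eval ξ) * (q ^ e * E * H * E)
          ≤ E * (K₁ * 1) * (q ^ e * E * H * E) := by
            refine mul_le_mul_of_nonneg_right (hRξ.trans ?_) (by positivity)
            gcongr
        _ = (E * K₁ * E * E) * (H * q ^ e) := by ring
        _ < H * (H * q ^ e) := by gcongr
        _ ≤ (H * q ^ e) ^ 2 := by
            rw [sq]
            gcongr
            exact le_mul_of_one_le_right hHpos.le hqe)
  rw [← evalAt_eq_eval_map] at hα
  refine ⟨R, α, H, (le_max_left _ _).trans_lt hPB, hR0, hRn, hRH.trans ?_, hα, ?_,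
    hdist.trans ?_⟩
  · gcongr
    rw [hK₂, mul_assoc (q ^ e * E)]
    exact le_mul_of_one_le_right (by positivity) (one_le_mul_of_one_le_of_one_le hK₁1 hE1)
  · rintro rfl
    exact hξ R hR0 hα
  · rw [hR'ξ, div_le_iff₀ (by positivity)]
    have : H ^ (-(n / 2) - 1 : ℝ) * H = H ^ (-(n / 2) : ℝ) := by
      rw [← Real.rpow_add_one hHpos.ne']
      ring_nf
    calc absVal ((R.map (polyEmb F)).eval ξ) ≤ E * (K₁ * H ^ (-(n / 2) : ℝ)) := hRξ
      _ = E * K₁ * (H ^ (-(n / 2) - 1 : ℝ) * H) := by rw [this]; ring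
      _ ≤ K₂ * q ^ e * (H ^ (-(n / 2) - 1 : ℝ) * H) := by
          refine mul_le_mul_of_nonneg_right ?_ (by rw [this]; exact hrp0.le)
          rw [hK₂]
          calc E * K₁ = 1 * (E * K₁) := by ring
            _ ≤ (q ^ e * E * q ^ e) * (E * K₁) := by
                refine mul_le_mul_of_nonneg_right ?_ (by positivity)
                exact one_le_mul_of_one_le_of_one_le
                  (one_le_mul_of_one_le_of_one_le hqe hE1) hqe
            _ = _ := by ring
      _ = _ := by ring

end Finite

section Finite

variable [Finite F]

/-! ### The classes -/

theorem limExp_wStarExp_le (ξ : LaurentSeries F) : limExp (wStarExp ξ) ≤ limExp (wExp ξ) := by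
  refine Filter.limsup_le_limsup ?_
  filter_upwards [Filter.eventually_ge_atTop 1] with n hn
  exact EReal.div_le_div_right_of_nonneg (EReal.coe_nonneg.2 n.cast_nonneg)
    (wStarExp_le_wExp ξ hn)

theorem limExp_wStarExp_nonneg (ξ : LaurentSeries F) : 0 ≤ limExp (wStarExp ξ) := by
  refine Filter.le_limsup_of_frequently_le (Filter.Eventually.frequently ?_)
  filter_upwards [Filter.eventually_ge_atTop 1] with n hn
  exact EReal.div_nonneg (wStarExp_nonneg ξ hn) (EReal.coe_nonneg.2 n.cast_nonneg)

theorem limExp_wExp_le (ξ : LaurentSeries F) :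
    limExp (wExp ξ) ≤ limExp (wStarExp ξ) + ((8 : ℝ) : EReal) := by
  have h : limExp (wExp ξ) ≤ Filter.limsup ((fun n : ℕ => wStarExp ξ n / ((n : ℝ) : EReal)) +
      fun _ => ((8 : ℝ) : EReal)) Filter.atTop := by
    refine Filter.limsup_le_limsup ?_
    filter_upwards [Filter.eventually_ge_atTop 1] with n hn
    have hn0 : (0 : ℝ) < n := by exact_mod_cast hn
    refine (EReal.div_le_div_right_of_nonneg (EReal.coe_nonneg.2 hn0.le)
      (wExp_le_wStarExp_add ξ hn)).trans ?_
    rw [EReal.div_right_distrib_of_nonneg (wStarExp_nonneg ξ hn)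
      (EReal.coe_nonneg.2 (by positivity)), ← EReal.coe_div, mul_div_cancel_right₀ _ hn0.ne']
    exact le_rfl
  refine h.trans ((EReal.limsup_add_le ?_ ?_).trans ?_)
  · right
    simp
  · right
    simp
  · simp [limExp]

theorem limExp_wExp_nonpos {ξ : LaurentSeries F} {M : F[X][X]} (hM : IsMinDefPoly M ξ) :
    limExp (wExp ξ) ≤ 0 := by
  have htend : Filter.Tendsto (fun n : ℕ => ((M.natDegree / n : ℝ) : EReal)) Filter.atTop
      (nhds ((0 : ℝ) : EReal)) :=
    (continuous_coe_real_ereal.tendsto 0).comp (tendsto_const_div_atTop_nhds_zero_nat _)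
  rw [← EReal.coe_zero, ← htend.limsup_eq]
  refine Filter.limsup_le_limsup (Filter.Eventually.of_forall fun n => ?_)
  dsimp only
  rw [EReal.coe_div]
  exact EReal.div_le_div_right_of_nonneg (EReal.coe_nonneg.2 n.cast_nonneg)
    (wExp_le_of_isMinDefPoly hM n)

theorem limExp_wStarExp_pos {ξ : LaurentSeries F}
    (hξ : ∀ P : F[X][X], P ≠ 0 → evalAt P ξ ≠ 0) : 0 < limExp (wStarExp ξ) := by
  refine lt_of_lt_of_le (b := ((1 / 4 : ℝ) : EReal)) (EReal.coe_pos.2 (by norm_num))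
    (Filter.le_limsup_of_frequently_le (Filter.frequently_atTop.2 fun N => ?_))
  refine ⟨2 * (N + 1), by lia, ?_⟩
  have h := half_le_wStarExp hξ (n := N + 1) (by lia)
  refine le_trans (le_of_eq ?_) (EReal.div_le_div_right_of_nonneg
    (EReal.coe_nonneg.2 (2 * (N + 1) : ℕ).cast_nonneg) h)
  rw [← EReal.coe_div]
  congr 1
  push_cast
  have : (N : ℝ) + 1 ≠ 0 := by positivity
  field_simp
  norm_num

/-- Either condition is equivalent to `ξ` being algebraic over `F(T)`. -/
theorem limExp_wExp_eq_zero_iff (ξ : LaurentSeries F) :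
    limExp (wExp ξ) = 0 ↔ limExp (wStarExp ξ) = 0 := by
  have h1 := limExp_wStarExp_le ξ
  have h2 := limExp_wStarExp_nonneg ξ
  by_cases hξ : ∃ P : F[X][X], P ≠ 0 ∧ evalAt P ξ = 0
  · obtain ⟨M, hM⟩ := exists_isMinDefPoly_iff.2 hξ
    have h3 := limExp_wExp_nonpos hM
    exact iff_of_true (le_antisymm h3 (h2.trans h1)) (le_antisymm (h1.trans h3) h2)
  · push Not at hξ
    have h3 := limExp_wStarExp_pos hξ
    exact iff_of_false (h3.trans_le h1).ne' h3.ne'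

theorem limExp_wExp_eq_top_iff (ξ : LaurentSeries F) :
    limExp (wExp ξ) = ⊤ ↔ limExp (wStarExp ξ) = ⊤ := by
  constructor
  · intro h
    have := limExp_wExp_le ξ
    rw [h, top_le_iff] at this
    by_contra hne
    exact EReal.add_ne_top hne (EReal.coe_ne_top 8) this
  · intro h
    have := limExp_wStarExp_le ξ
    rwa [h, top_le_iff] at this

theorem wExp_eq_top_iff (ξ : LaurentSeries F) {n : ℕ} (hn : 1 ≤ n) :
    wExp ξ n = ⊤ ↔ wStarExp ξ n = ⊤ := by
  constructor
  · intro h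
    have := wExp_le_wStarExp_add ξ hn
    rw [h, top_le_iff] at this
    by_contra hne
    exact EReal.add_ne_top hne (EReal.coe_ne_top (8 * n)) this
  · intro h
    have := wStarExp_le_wExp ξ hn
    rwa [h, top_le_iff] at this

theorem limExp_wExp_pos_iff (ξ : LaurentSeries F) :
    0 < limExp (wExp ξ) ↔ 0 < limExp (wStarExp ξ) := by
  have h2 := limExp_wStarExp_nonneg ξ
  rw [h2.lt_iff_ne', (h2.trans (limExp_wStarExp_le ξ)).lt_iff_ne', ne_eq, ne_eq,
    limExp_wExp_eq_zero_iff]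

end Finite

end MahlerKoksma

end

theorem theorem1p3 (F : Type*) [Field F] [Finite F] :
    MahlerKoksma.classA F = MahlerKoksma.classAStar F ∧
    MahlerKoksma.classS F = MahlerKoksma.classSStar F ∧
    MahlerKoksma.classT F = MahlerKoksma.classTStar F ∧
    MahlerKoksma.classU F = MahlerKoksma.classUStar F := by
  refine ⟨?_, ?_, ?_, ?_⟩ <;> ext ξ
  · exact MahlerKoksma.limExp_wExp_eq_zero_iff ξ
  · exact and_congr (MahlerKoksma.limExp_wExp_pos_iff ξ) (by
      rw [lt_top_iff_ne_top, lt_top_iff_ne_top, ne_eq, ne_eq,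
        MahlerKoksma.limExp_wExp_eq_top_iff])
  · exact and_congr (MahlerKoksma.limExp_wExp_eq_top_iff ξ) (forall₂_congr fun n hn => by
      rw [lt_top_iff_ne_top, lt_top_iff_ne_top, ne_eq, ne_eq, MahlerKoksma.wExp_eq_top_iff ξ hn])
  · exact and_congr (MahlerKoksma.limExp_wExp_eq_top_iff ξ) (exists_congr fun n =>
      and_congr_right fun hn => MahlerKoksma.wExp_eq_top_iff ξ hn)
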